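/- A partial linear space consists of a non-empty set $P$ of points and a family of proper subsets of $P$, called lines, such that each line contains at least two points, every point lies on a line, and any two distinct points lie on at most one common line. Points $p,q$ are collinear, $p\perp q$, if some line contains both. A subspace is a set $S\subset P$ which contains the line through any two distinct collinear points of $S$; it is singular if any two of its points are collinear. $\langle X\rangle$ denotes the smallest subspace containing $X$; $X$ is independent if no proper subset of $X$ spans $\langle X\rangle$; a base of a subspace $S$ is an independent subset of $S$ spanning $S$; and $\dim S$ is the smallest $d$ such that $S$ has a base of cardinality $d+1$ (so $\dim\emptyset=-1$). A polar space is a partial linear space $\Pi$ such that each line contains at least three points, no point is collinear with all points, for every point $p$ and line $L$ the point $p$ is collinear with exactly one or with all points of $L$, and every chain (flag) of singular subspaces is finite. Its maximal singular subspaces all have the same dimension $n-1$, and $n$ is called the rank of $\Pi$. Let $\Pi$ be a polar space of rank $n$. Let $\mathcal G_k(\Pi)$ be the set of $k$-dimensional singular subspaces. The dual polar graph $\Gamma_{n-1}(\Pi)$ has vertex set $\mathcal G_{n-1}(\Pi)$, with $S,U$ adjacent if and only if $\dim(S\cap U)=n-2$. A frame of $\Pi$ is a set $B$ of $2n$ points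 such that each point of $B$ is non-collinear with exactly one point of $B$; the associated apartment of $\mathcal G_{n-1}(\Pi)$ is the set of all maximal singular subspaces spanned by subsets of $B$. For a singular subspace $M$, let $[M\rangle_{n-1}$ be the set of all elements of $\mathcal G_{n-1}(\Pi)$ containing $M$; an apartment of $[M\rangle_{n-1}$ is the intersection of $[M\rangle_{n-1}$ with the apartment associated with a frame $B$ such that $M$ is spanned by a subset of $B$. Let $H_m$ be the $m$-dimensional hypercube graph; an isometric embedding of graphs is a distance preserving injection of the vertex sets. **Theorem 2.** Let $m\le n$. For every isometric embedding of $H_m$ in $\Gamma_{n-1}(\Pi)$ there is an $(n-m-1)$-dimensional singular subspace $M$ of $\Pi$ such that the image of the embedding is an apartment of $[M\rangle_{n-1}$. In particular ($m=n$), the images of isometric embeddings of $H_n$ in $\Gamma_{n-1}(\Pi)$ are exactly the apartments of $\mathcal G_{n-1}(\Pi)$. -/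

import Mathlib

/-- A partial linear space on the point set `P`: a non-empty set of points together with a family
of proper subsets, the lines. -/
structure PartialLinearSpace (P : Type*) where
  /-- The family of lines. -/
  lines : Set (Set P)
  nonempty : Nonempty P
  line_ne_univ : ∀ L ∈ lines, L ≠ Set.univ
  two_points : ∀ L ∈ lines, ∃ p ∈ L, ∃ q ∈ L, p ≠ q
  exists_line : ∀ p : P, ∃ L ∈ lines, p ∈ L
  line_unique : ∀ p q : P, p ≠ q → ∀ L ∈ lines, ∀ L' ∈ lines,
    p ∈ L → q ∈ L → p ∈ L' → q ∈ L' → L = L'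

namespace PartialLinearSpace

variable {P : Type*} (Q : PartialLinearSpace P)

/-- Two points are collinear (`p ⊥ q`) if some line contains both of them. -/
def Collinear (p q : P) : Prop := ∃ L ∈ Q.lines, p ∈ L ∧ q ∈ L

/-- A subspace contains the line through any two of its distinct collinear points. -/
def IsSubspace (S : Set P) : Prop :=
  ∀ p ∈ S, ∀ q ∈ S, p ≠ q → ∀ L ∈ Q.lines, p ∈ L → q ∈ L → L ⊆ S

/-- A singular subspace: a subspace any two points of which are collinear. -/
def IsSingular (S : Set P) : Prop :=
  Q.IsSubspace S ∧ ∀ p ∈ S, ∀ q ∈ S, Q.Collinear p q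

/-- A maximal singular subspace. -/
def IsMaximalSingular (S : Set P) : Prop := Maximal Q.IsSingular S

/-- The subspace `⟨X⟩` spanned by `X`: the intersection of all subspaces containing `X`. -/
def span (X : Set P) : Set P := ⋂₀ {S | Q.IsSubspace S ∧ X ⊆ S}

/-- `X` is independent if `⟨X⟩` is not spanned by a proper subset of `X`. -/
def IsIndependent (X : Set P) : Prop := ∀ Y : Set P, Y ⊂ X → Q.span Y ≠ Q.span X

/-- A base of `S`: an independent subset of `S` that spans `S`. -/
def IsBase (S X : Set P) : Prop := X ⊆ S ∧ Q.IsIndependent X ∧ Q.span X = S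

/-- `S` has the (finite) dimension `d`: `d + 1` is the smallest cardinality of a base of `S`.
The empty subspace has dimension `-1`. -/
def HasDim (S : Set P) (d : ℤ) : Prop :=
  IsLeast {k : ℤ | ∃ X : Finset P, Q.IsBase S (X : Set P) ∧ (X.card : ℤ) - 1 = k} d

/-- The polar space axioms. -/
structure IsPolarSpace : Prop where
  three_points : ∀ L ∈ Q.lines,
    ∃ p ∈ L, ∃ q ∈ L, ∃ r ∈ L, p ≠ q ∧ p ≠ r ∧ q ≠ r
  nondegenerate : ∀ p : P, ∃ q : P, ¬ Q.Collinear p q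
  one_or_all : ∀ p : P, ∀ L ∈ Q.lines,
    (∃! q : P, q ∈ L ∧ Q.Collinear p q) ∨ ∀ q ∈ L, Q.Collinear p q
  finite_flags : ∀ F : Set (Set P), (∀ S ∈ F, Q.IsSingular S) → IsChain (· ⊆ ·) F → F.Finite

/-- The rank of a polar space is `n` if its maximal singular subspaces have dimension `n - 1`.
All maximal singular subspaces of a polar space have the same dimension, so it is enough to ask
this for one of them. -/
def HasRank (n : ℕ) : Prop :=
  ∃ S : Set P, Q.IsMaximalSingular S ∧ Q.HasDim S ((n : ℤ) - 1)

/-- The Grassmannian of all `k`-dimensional singular subspaces. -/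
def grassmannian (k : ℤ) : Set (Set P) := {S | Q.IsSingular S ∧ Q.HasDim S k}

/-- The dual polar graph of a polar space of rank `n`: its vertices are the `(n-1)`-dimensional
singular subspaces, two of them being adjacent if their intersection is `(n-2)`-dimensional. -/
def dualPolarGraph (n : ℕ) : SimpleGraph (Q.grassmannian ((n : ℤ) - 1)) where
  Adj S U := Q.HasDim ((S : Set P) ∩ (U : Set P)) ((n : ℤ) - 2)
  symm := ⟨fun S U h => by rwa [Set.inter_comm]⟩
  loopless := ⟨fun S h => by
    rw [Set.inter_self] at h
    have h1 := S.2.2.unique h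
    omega⟩

/-- The set `[M⟩_k` of all `k`-dimensional singular subspaces containing `M`. -/
def parabolic (M : Set P) (k : ℤ) : Set (Set P) := {S | S ∈ Q.grassmannian k ∧ M ⊆ S}

/-- A frame of a polar space of rank `n`: a set of `2n` points such that each of them is
non-collinear with exactly one point of the set. -/
def IsFrame (n : ℕ) (B : Set P) : Prop :=
  B.encard = 2 * n ∧ ∀ p ∈ B, ∃! q : P, q ∈ B ∧ ¬ Q.Collinear p q

/-- The apartment associated with `B`: all maximal singular subspaces spanned by subsets of `B`. -/
def apartment (B : Set P) : Set (Set P) :=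
  {S | Q.IsMaximalSingular S ∧ ∃ X : Set P, X ⊆ B ∧ Q.span X = S}

/-- `𝒜` is an apartment of the Grassmannian of maximal singular subspaces. -/
def IsApartment (n : ℕ) (𝒜 : Set (Set P)) : Prop :=
  ∃ B : Set P, Q.IsFrame n B ∧ 𝒜 = Q.apartment B

/-- `𝒜` is an apartment of `[M⟩_{n-1}`: the intersection of `[M⟩_{n-1}` with the apartment
associated with a frame `B` such that `M` is spanned by a subset of `B`. -/
def IsParabolicApartment (n : ℕ) (M : Set P) (𝒜 : Set (Set P)) : Prop :=
  ∃ B : Set P, Q.IsFrame n B ∧ (∃ X : Set P, X ⊆ B ∧ Q.span X = M) ∧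
    𝒜 = Q.apartment B ∩ Q.parabolic M ((n : ℤ) - 1)

end PartialLinearSpace

/-- The `m`-dimensional hypercube graph. The vertex `v` stands for the maximal singular subset of
`{1, …, m, -1, …, -m}` that contains `i` if `v i` is true and `-i` otherwise; two such subsets are
adjacent if they have exactly `m - 1` common elements, that is, if they differ at exactly one
index. -/
def hypercubeGraph (m : ℕ) : SimpleGraph (Fin m → Bool) where
  Adj v w := ∃! i : Fin m, v i ≠ w i
  symm := ⟨fun v w h => by simpa only [ne_comm] using h⟩
  loopless := ⟨fun v h => by
    obtain ⟨i, hi, -⟩ := h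
    exact hi rfl⟩

/-- An isometric embedding of (connected) graphs: a distance preserving injection. -/
def IsIsometricEmbedding {V W : Type*} (G : SimpleGraph V) (H : SimpleGraph W)
    (f : V → W) : Prop :=
  Function.Injective f ∧ ∀ v w : V, H.edist (f v) (f w) = G.edist v w

/-! Write `rk` for the smallest number of points spanning a singular subspace, so that `rk` is the
dimension plus one. The distance of `S` and `U` in the dual polar graph is `n - rk (S ∩ U)`, and the
distance in the hypercube is the Hamming distance. An isometric embedding is therefore a family `F
v` of maximal singular subspaces with `rk (F v ∩ F w) = n - hammingDist v w`.

If `u` lies on a geodesic from `v` to `w`, the modular inequality inside `F u` gives `F v ∩ F w ⊆ F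
u`. Hence `M = F (true, …, true) ∩ F (false, …, false)` lies in every `F v`; it has rank `n - m` and
equals `F v ∩ F w` for every antipodal pair. For each index `i` and sign `a`, some point `x i a`
outside `M` lies in all `F v` with `v i = a`. Maximality shows that `x i true` and `x i false` are
non-collinear, while points with different indices lie in a common `F v`. Counting ranks, `F v` is
spanned by `M` and the points `x i (v i)` (`exists_pairs_of_rk_inter`).

To obtain a frame, a base of `M` is added and its points are given partners (`exists_partners`).
These exist because a point outside the span of finitely many pairwise collinear points is separated
from them by the perp of some point (`exists_perp_not_collinear`). Conversely, the subspaces chosen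
from the pairs of a frame meet in the required ranks (`rk_inter_choiceSpan`).

The rank calculus rests on the description of the span of a singular subspace and a point as a union
of lines (`mem_span_insert`). It yields exchange, strict monotonicity of `rk` and modularity, all
directly from the one-or-all axiom. -/

namespace PartialLinearSpace

variable {P : Type*} {Q : PartialLinearSpace P}

/-! ### Collinearity, subspaces and spans -/

theorem Collinear.symm {p q : P} (h : Q.Collinear p q) : Q.Collinear q p := by
  obtain ⟨L, hL, hp, hq⟩ := h
  exact ⟨L, hL, hq, hp⟩

theorem collinear_comm {p q : P} : Q.Collinear p q ↔ Q.Collinear q p :=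
  ⟨Collinear.symm, Collinear.symm⟩

theorem collinear_refl (Q : PartialLinearSpace P) (p : P) : Q.Collinear p p := by
  obtain ⟨L, hL, hp⟩ := Q.exists_line p
  exact ⟨L, hL, hp, hp⟩

theorem subset_span (Q : PartialLinearSpace P) (X : Set P) : X ⊆ Q.span X :=
  Set.subset_sInter fun _ h => h.2

theorem span_subset {X S : Set P} (hS : Q.IsSubspace S) (h : X ⊆ S) : Q.span X ⊆ S :=
  Set.sInter_subset_of_mem ⟨hS, h⟩

theorem isSubspace_span (Q : PartialLinearSpace P) (X : Set P) : Q.IsSubspace (Q.span X) := by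
  intro p hp q hq hpq L hL hpL hqL
  refine Set.subset_sInter fun S hS => ?_
  exact hS.1 p (hp S hS) q (hq S hS) hpq L hL hpL hqL

theorem span_mono {X Y : Set P} (h : X ⊆ Y) : Q.span X ⊆ Q.span Y :=
  span_subset (Q.isSubspace_span Y) (h.trans (Q.subset_span Y))

theorem IsSubspace.span_eq {S : Set P} (h : Q.IsSubspace S) : Q.span S = S :=
  (span_subset h subset_rfl).antisymm (Q.subset_span S)

theorem IsSubspace.inter {S T : Set P} (hS : Q.IsSubspace S) (hT : Q.IsSubspace T) :
    Q.IsSubspace (S ∩ T) := fun p hp q hq hpq L hL hpL hqL =>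
  Set.subset_inter (hS p hp.1 q hq.1 hpq L hL hpL hqL) (hT p hp.2 q hq.2 hpq L hL hpL hqL)

theorem isSubspace_empty (Q : PartialLinearSpace P) : Q.IsSubspace ∅ :=
  fun _ hp => hp.elim

theorem span_insert_span (a : P) (X : Set P) :
    Q.span (insert a (Q.span X)) = Q.span (insert a X) := by
  apply (span_subset (Q.isSubspace_span _) _).antisymm
  · exact span_mono (Set.insert_subset_insert (Q.subset_span X))
  · exact Set.insert_subset (Q.subset_span _ (Set.mem_insert _ _))
      (span_mono (Set.subset_insert _ _))

/-- The points collinear with all points of `X`. -/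
def perp (Q : PartialLinearSpace P) (X : Set P) : Set P := {y | ∀ x ∈ X, Q.Collinear y x}

theorem IsSingular.mono {S T : Set P} (hS : Q.IsSingular S) (hT : Q.IsSubspace T) (h : T ⊆ S) :
    Q.IsSingular T :=
  ⟨hT, fun p hp q hq => hS.2 p (h hp) q (h hq)⟩

theorem isSingular_empty (Q : PartialLinearSpace P) : Q.IsSingular ∅ :=
  ⟨Q.isSubspace_empty, fun _ hp => hp.elim⟩

/-! ### Perps and spans in polar spaces -/

namespace IsPolarSpace

theorem collinear_of_mem_line (hQ : Q.IsPolarSpace) {p x y z : P} {L : Set P} (hL : L ∈ Q.lines)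
    (hx : x ∈ L) (hy : y ∈ L) (hz : z ∈ L) (hxy : x ≠ y) (hpx : Q.Collinear p x)
    (hpy : Q.Collinear p y) : Q.Collinear p z := by
  rcases hQ.one_or_all p L hL with h | h
  · exact absurd (h.unique ⟨hx, hpx⟩ ⟨hy, hpy⟩) hxy
  · exact h z hz

theorem exists_collinear_mem_line (hQ : Q.IsPolarSpace) (p : P) {L : Set P} (hL : L ∈ Q.lines) :
    ∃ z ∈ L, Q.Collinear p z := by
  rcases hQ.one_or_all p L hL with h | h
  · exact h.exists
  · obtain ⟨q, hq, -⟩ := Q.two_points L hL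
    exact ⟨q, hq, h q hq⟩

/-- On the line joining `x` to `y` there is a point different from `x` collinear with `p`,
provided that `p` and `x` are non-collinear. -/
theorem exists_collinear_ne (hQ : Q.IsPolarSpace) {p x y : P} (h : Q.Collinear x y)
    (hp : ¬ Q.Collinear p x) :
    ∃ z, ∃ L ∈ Q.lines, x ∈ L ∧ y ∈ L ∧ z ∈ L ∧ Q.Collinear p z ∧ z ≠ x := by
  obtain ⟨L, hL, hx, hy⟩ := h
  obtain ⟨z, hz, hpz⟩ := hQ.exists_collinear_mem_line p hL
  refine ⟨z, L, hL, hx, hy, hz, hpz, ?_⟩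
  rintro rfl
  exact hp hpz

theorem isSubspace_perp (hQ : Q.IsPolarSpace) (X : Set P) : Q.IsSubspace (Q.perp X) :=
  fun _ hp _ hq hpq _ hL hpL hqL _ hz x hx =>
    (hQ.collinear_of_mem_line hL hpL hqL hz hpq (hp x hx).symm (hq x hx).symm).symm

theorem collinear_span (hQ : Q.IsPolarSpace) {X : Set P} {p : P}
    (h : ∀ x ∈ X, Q.Collinear p x) : ∀ x ∈ Q.span X, Q.Collinear p x := by
  intro x hx
  have h1 : Q.span X ⊆ Q.perp {p} :=
    span_subset (hQ.isSubspace_perp _) (by rintro y hy _ rfl; exact (h y hy).symm)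
  exact (h1 hx p rfl).symm

theorem isSingular_span (hQ : Q.IsPolarSpace) {X : Set P}
    (h : ∀ x ∈ X, ∀ y ∈ X, Q.Collinear x y) : Q.IsSingular (Q.span X) :=
  ⟨Q.isSubspace_span X, fun x hx => hQ.collinear_span fun y hy =>
    (hQ.collinear_span (h y hy) x hx).symm⟩

theorem isSingular_span_insert (hQ : Q.IsPolarSpace) {A : Set P} {a : P} (hA : Q.IsSingular A)
    (ha : ∀ s ∈ A, Q.Collinear a s) : Q.IsSingular (Q.span (insert a A)) := by
  apply hQ.isSingular_span
  rintro x (rfl | hx) y (rfl | hy)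
  · exact Q.collinear_refl _
  · exact ha y hy
  · exact (ha x hx).symm
  · exact hA.2 x hx y hy

/-- The perp of a point is not contained in the perp of a different point. -/
theorem exists_collinear_not_collinear (hQ : Q.IsPolarSpace) {p q : P} (hpq : p ≠ q) :
    ∃ z, Q.Collinear p z ∧ ¬ Q.Collinear q z := by
  by_contra! hall
  obtain ⟨L, hL, hpL, hqL⟩ := (hall p (Q.collinear_refl p)).symm
  obtain ⟨r, hr⟩ := hQ.nondegenerate q
  have hrp : ¬ Q.Collinear p r := fun h => hr (hall r h)
  -- The point `s` of the line `pq` will turn out to be collinear with an arbitrary `z`, against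
  -- non-degeneracy: a point `x` near `z` collinear with `p` is also collinear with `q`, hence with
  -- `s`.
  obtain ⟨s, hsL, hrs⟩ := hQ.exists_collinear_mem_line r hL
  have hsp : s ≠ p := by rintro rfl; exact hrp hrs.symm
  have hsq : s ≠ q := by rintro rfl; exact hr hrs.symm
  have hps : Q.Collinear p s := ⟨L, hL, hpL, hsL⟩
  obtain ⟨z, hz⟩ := hQ.nondegenerate s
  obtain ⟨y, K, hK, hsK, hrK, hyK, hzy, hys⟩ :=
    hQ.exists_collinear_ne hrs.symm (fun h => hz h.symm)
  have hyp : ¬ Q.Collinear p y := fun h =>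
    hrp (hQ.collinear_of_mem_line hK hsK hyK hrK hys.symm hps h)
  obtain ⟨x, N, hN, hyN, hzN, hxN, hpx, hxy⟩ := hQ.exists_collinear_ne hzy.symm hyp
  have hxs : Q.Collinear x s :=
    hQ.collinear_of_mem_line hL hpL hqL hsL hpq hpx.symm (hall x hpx).symm
  exact hz (hQ.collinear_of_mem_line hN hxN hyN hzN hxy hxs.symm ⟨K, hK, hsK, hyK⟩)

/-- The common part of the inductive proof that a singular subspace is the perp of its perp. -/
theorem exists_perp_pair_of_perp (hQ : Q.IsPolarSpace) {E : Set P} {b c f : P} {K : Set P}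
    (hK : K ∈ Q.lines) (hb : b ∈ K) (hc : c ∈ K) (hfK : f ∉ K)
    (hfb : Q.Collinear f b) (hfc : Q.Collinear f c) (hfE : ∀ e ∈ E, Q.Collinear f e)
    (hfirst : ∃ t, (∀ e ∈ E, Q.Collinear t e) ∧ Q.Collinear t f ∧ ¬ Q.Collinear t b)
    (hsecond : ∀ u ∈ K, ∃ v, (∀ e ∈ E, Q.Collinear v e) ∧ Q.Collinear v u ∧
      ¬ Q.Collinear v f) :
    ∃ x, (∀ e ∈ E, Q.Collinear x e) ∧ Q.Collinear x b ∧ Q.Collinear x c ∧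
      ¬ Q.Collinear x f := by
  by_contra! hall
  obtain ⟨t, htE, htf, htb⟩ := hfirst
  obtain ⟨u, huK, htu⟩ := hQ.exists_collinear_mem_line t hK
  have hub : u ≠ b := by rintro rfl; exact htb htu
  by_cases hbc : b = c
  · subst hbc
    obtain ⟨v, hvE, hvb, hvf⟩ := hsecond b hb
    exact hvf (hall v hvE hvb hvb)
  obtain ⟨v, hvE, hvu, hvf⟩ := hsecond u huK
  have key : ∀ x, (∀ e ∈ E, Q.Collinear x e) → Q.Collinear x u → Q.Collinear x b →
      Q.Collinear x f := fun x hx hxu hxb =>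
    hall x hx hxb (hQ.collinear_of_mem_line hK huK hb hc hub hxu hxb)
  have hfu : Q.Collinear f u := hQ.collinear_of_mem_line hK hb hc huK hbc hfb hfc
  -- Two moves along lines: `s` on `ft` is made collinear with `v`, then `x` on `sv` is made
  -- collinear with `b`. Both stay collinear with `E` and `u`, so `key` applies to `x`; but then
  -- `f`, collinear with `s` and `x`, would be collinear with `v`.
  obtain ⟨s, L, hL, hfL, htL, hsL, hvs, hsf⟩ := hQ.exists_collinear_ne htf.symm hvf
  have htf' : t ≠ f := by rintro rfl; exact htb hfb
  have hperp : ∀ y, Q.Collinear f y → Q.Collinear t y → Q.Collinear s y := fun y h1 h2 =>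
    (hQ.collinear_of_mem_line hL hfL htL hsL htf'.symm h1.symm h2.symm).symm
  have hsb : ¬ Q.Collinear s b := fun h =>
    htb (hQ.collinear_of_mem_line hL hfL hsL htL hsf.symm hfb.symm h.symm).symm
  have hsu := hperp u hfu htu
  have hsf2 := hperp f (Q.collinear_refl f) htf
  obtain ⟨x, N, hN, hsN, hvN, hxN, hbx, hxs⟩ :=
    hQ.exists_collinear_ne hvs.symm (fun h => hsb h.symm)
  have hvs' : v ≠ s := by rintro rfl; exact hvf hsf2
  have hxperp : ∀ y, Q.Collinear v y → Q.Collinear s y → Q.Collinear x y := fun y h1 h2 =>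
    (hQ.collinear_of_mem_line hN hvN hsN hxN hvs' h1.symm h2.symm).symm
  have hxf := key x (fun e he => hxperp e (hvE e he) (hperp e (hfE e he) (htE e he)))
    (hxperp u hvu hsu) hbx.symm
  exact hvf (hQ.collinear_of_mem_line hN hxN hsN hvN hxs hxf.symm hsf2.symm).symm

/-- The case of a line (or of a point, if `b = c`) is needed before the general separation
statement, whose proof uses the exchange property. -/
theorem exists_perp_line_not_collinear (hQ : Q.IsPolarSpace) {b c f : P} {K : Set P}
    (hK : K ∈ Q.lines) (hb : b ∈ K) (hc : c ∈ K) (hfK : f ∉ K)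
    (hfb : Q.Collinear f b) (hfc : Q.Collinear f c) :
    ∃ x, Q.Collinear x b ∧ Q.Collinear x c ∧ ¬ Q.Collinear x f := by
  obtain ⟨x, -, h⟩ := hQ.exists_perp_pair_of_perp (E := ∅) hK hb hc hfK hfb hfc (by simp)
    (by
      obtain ⟨t, h1, h2⟩ := hQ.exists_collinear_not_collinear
        (p := f) (q := b) (by rintro rfl; exact hfK hb)
      exact ⟨t, by simp, h1.symm, fun h => h2 h.symm⟩)
    (by
      intro u hu
      obtain ⟨t, h1, h2⟩ := hQ.exists_collinear_not_collinear
        (p := u) (q := f) (by rintro rfl; exact hfK hu)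
      exact ⟨t, by simp, h1.symm, fun h => h2 h.symm⟩)
  exact ⟨x, h⟩

/-- The perp of a point meets a singular plane not contained in it in at most a line. -/
theorem mem_line_of_mem_plane (hQ : Q.IsPolarSpace) {a b c p f : P} {K : Set P}
    (hK : K ∈ Q.lines) (hb : b ∈ K) (hc : c ∈ K) (hbc : b ≠ c)
    (hab : Q.Collinear a b) (hac : Q.Collinear a c)
    (hpb : Q.Collinear p b) (hpc : Q.Collinear p c) (hpa : ¬ Q.Collinear p a)
    (hf : f ∈ Q.span {a, b, c}) (hpf : Q.Collinear p f) : f ∈ K := by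
  by_contra hfK
  have hbc' : Q.Collinear b c := ⟨K, hK, hb, hc⟩
  have hπ : Q.IsSingular (Q.span {a, b, c}) := by
    apply hQ.isSingular_span
    rintro x (rfl | rfl | rfl) y (rfl | rfl | rfl) <;>
      first | exact Q.collinear_refl _ | assumption | (apply Collinear.symm; assumption)
  have ha : a ∈ Q.span {a, b, c} := Q.subset_span _ (by simp)
  have hb' : b ∈ Q.span {a, b, c} := Q.subset_span _ (by simp)
  have hc' : c ∈ Q.span {a, b, c} := Q.subset_span _ (by simp)
  have hperp : ∀ y, Q.Collinear y a → Q.Collinear y b → Q.Collinear y c → Q.Collinear y f := by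
    intro y h1 h2 h3
    refine hQ.collinear_span ?_ f hf
    rintro x (rfl | rfl | rfl) <;> assumption
  -- Starting from `q`, the points `r` on `xq` and `t` on `pr` remain collinear with `b` and `c`. As
  -- `t` is also collinear with `a`, it is collinear with the whole plane, in particular with `f`;
  -- this forces `r` and then `q` to be collinear with `f`.
  obtain ⟨q, hqb, hqc, hqf⟩ := hQ.exists_perp_line_not_collinear hK hb hc hfK
    (hπ.2 f hf b hb') (hπ.2 f hf c hc')
  have hqa : ¬ Q.Collinear q a := fun h => hqf (hperp q h hqb hqc)
  obtain ⟨x, L, hL, haL, hfL, hxL, hqx, hxa⟩ :=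
    hQ.exists_collinear_ne (hπ.2 a ha f hf) hqa
  have haf : a ≠ f := by rintro rfl; exact hpa hpf
  have hxf : x ≠ f := by rintro rfl; exact hqf hqx
  have hxπ : x ∈ Q.span {a, b, c} := hπ.1 a ha f hf haf L hL haL hfL hxL
  have hpx : ¬ Q.Collinear p x := fun h =>
    hpa (hQ.collinear_of_mem_line hL hxL hfL haL hxf h hpf)
  have hxq : x ≠ q := by rintro rfl; exact hqf (hπ.2 _ hxπ f hf)
  obtain ⟨r, N, hN, hxN, hqN, hrN, hpr, hrx⟩ := hQ.exists_collinear_ne hqx.symm hpx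
  have hrperp : ∀ y, Q.Collinear x y → Q.Collinear q y → Q.Collinear r y := fun y h1 h2 =>
    (hQ.collinear_of_mem_line hN hxN hqN hrN hxq h1.symm h2.symm).symm
  have hrf : ¬ Q.Collinear r f := fun h =>
    hqf (hQ.collinear_of_mem_line hN hxN hrN hqN hrx.symm (hπ.2 f hf x hxπ) h.symm).symm
  have hrb := hrperp b (hπ.2 x hxπ b hb') hqb
  have hrc := hrperp c (hπ.2 x hxπ c hc') hqc
  obtain ⟨t, T, hT, hpT, hrT, htT, hat, htp⟩ :=
    hQ.exists_collinear_ne hpr (fun h => hpa h.symm)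
  have hpr' : p ≠ r := by rintro rfl; exact hrf hpf
  have htperp : ∀ y, Q.Collinear p y → Q.Collinear r y → Q.Collinear t y := fun y h1 h2 =>
    (hQ.collinear_of_mem_line hT hpT hrT htT hpr' h1.symm h2.symm).symm
  have htf := hperp t hat.symm (htperp b hpb hrb) (htperp c hpc hrc)
  exact hrf (hQ.collinear_of_mem_line hT hpT htT hrT htp.symm hpf.symm htf.symm).symm

/-- The span of a singular subspace `A` and a point `a` is the union of the lines joining `a` to
the points of `A`. -/
theorem mem_span_insert (hQ : Q.IsPolarSpace) {A : Set P} {a y : P} (hA : Q.IsSingular A)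
    (ha : ∀ s ∈ A, Q.Collinear a s) (hy : y ∈ Q.span (insert a A)) :
    y = a ∨ ∃ s ∈ A, ∃ L ∈ Q.lines, a ∈ L ∧ s ∈ L ∧ y ∈ L := by
  by_cases haA : a ∈ A
  · rw [Set.insert_eq_of_mem haA, hA.1.span_eq] at hy
    obtain ⟨L, hL, h1, h2⟩ := ha y hy
    exact Or.inr ⟨y, hy, L, hL, h1, h2, h2⟩
  suffices h : Q.IsSubspace {y | y = a ∨ ∃ s ∈ A, ∃ L ∈ Q.lines, a ∈ L ∧ s ∈ L ∧ y ∈ L} by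
    refine span_subset h (Set.insert_subset (Or.inl rfl) fun s hs => ?_) hy
    obtain ⟨L, hL, h1, h2⟩ := ha s hs
    exact Or.inr ⟨s, hs, L, hL, h1, h2, h2⟩
  intro y₁ h₁ y₂ h₂ hne L hL hy₁ hy₂ z hz
  by_cases e₁ : y₁ = a
  · subst e₁
    obtain rfl | ⟨s, hs, L', hL', h1, h2, h3⟩ := h₂
    · exact absurd rfl hne
    · obtain rfl := Q.line_unique _ _ hne L hL L' hL' hy₁ hy₂ h1 h3
      exact Or.inr ⟨s, hs, L, hL, h1, h2, hz⟩
  by_cases e₂ : y₂ = a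
  · subst e₂
    obtain rfl | ⟨s, hs, L', hL', h1, h2, h3⟩ := h₁
    · exact absurd rfl hne
    · obtain rfl := Q.line_unique _ _ hne L hL L' hL' hy₁ hy₂ h3 h1
      exact Or.inr ⟨s, hs, L, hL, h1, h2, hz⟩
  obtain ⟨s₁, hs₁, L₁, hL₁, haL₁, hsL₁, hyL₁⟩ := h₁.resolve_left e₁
  obtain ⟨s₂, hs₂, L₂, hL₂, haL₂, hsL₂, hyL₂⟩ := h₂.resolve_left e₂
  by_cases hLL : L₁ = L₂
  · subst hLL
    obtain rfl := Q.line_unique _ _ hne L hL L₁ hL₁ hy₁ hy₂ hyL₁ hyL₂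
    exact Or.inr ⟨s₁, hs₁, L, hL, haL₁, hsL₁, hz⟩
  have has₁ : a ≠ s₁ := by rintro rfl; exact haA hs₁
  have has₂ : a ≠ s₂ := by rintro rfl; exact haA hs₂
  have hss : s₁ ≠ s₂ := by
    rintro rfl
    exact hLL (Q.line_unique _ _ has₁ L₁ hL₁ L₂ hL₂ haL₁ hsL₁ haL₂ hsL₂)
  by_cases hza : z = a
  · exact Or.inl hza
  obtain ⟨K, hK, hsK₁, hsK₂⟩ := hA.2 s₁ hs₁ s₂ hs₂
  have hKA : K ⊆ A := hA.1 s₁ hs₁ s₂ hs₂ hss K hK hsK₁ hsK₂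
  have haK : a ∉ K := fun h => haA (hKA h)
  -- The perp of `p` cuts the plane of `a`, `s₁`, `s₂` exactly in `K`. Every line meets this perp,
  -- so the line `az` meets `K`: this replaces the Veblen–Young axiom.
  obtain ⟨p, hp₁, hp₂, hpa⟩ := hQ.exists_perp_line_not_collinear hK hsK₁ hsK₂ haK
    (ha _ hs₁) (ha _ hs₂)
  have hπ : Q.IsSubspace (Q.span {a, s₁, s₂}) := Q.isSubspace_span _
  have ha' : a ∈ Q.span {a, s₁, s₂} := Q.subset_span _ (by simp)
  have hs₁' : s₁ ∈ Q.span {a, s₁, s₂} := Q.subset_span _ (by simp)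
  have hs₂' : s₂ ∈ Q.span {a, s₁, s₂} := Q.subset_span _ (by simp)
  have hzπ : z ∈ Q.span {a, s₁, s₂} :=
    hπ _ (hπ _ ha' _ hs₁' has₁ _ hL₁ haL₁ hsL₁ hyL₁) _
      (hπ _ ha' _ hs₂' has₂ _ hL₂ haL₂ hsL₂ hyL₂) hne L hL hy₁ hy₂ hz
  have haz : Q.Collinear a z := by
    refine hQ.collinear_span ?_ z hzπ
    rintro x (rfl | rfl | rfl)
    · exact Q.collinear_refl _
    · exact ha _ hs₁
    · exact ha _ hs₂
  obtain ⟨N, hN, haN, hzN⟩ := haz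
  obtain ⟨g, hgN, hpg⟩ := hQ.exists_collinear_mem_line p hN
  have hgπ : g ∈ Q.span {a, s₁, s₂} := hπ _ ha' _ hzπ (Ne.symm hza) N hN haN hzN hgN
  exact Or.inr ⟨g, hKA (hQ.mem_line_of_mem_plane hK hsK₁ hsK₂ hss (ha _ hs₁) (ha _ hs₂)
    hp₁ hp₂ hpa hgπ hpg), N, hN, haN, hgN, hzN⟩

theorem mem_span_insert_exchange (hQ : Q.IsPolarSpace) {A : Set P} {a y : P}
    (hA : Q.IsSingular A) (ha : ∀ s ∈ A, Q.Collinear a s) (hy : y ∈ Q.span (insert a A))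
    (hyA : y ∉ A) : a ∈ Q.span (insert y A) := by
  obtain rfl | ⟨s, hs, L, hL, haL, hsL, hyL⟩ := hQ.mem_span_insert hA ha hy
  · exact Q.subset_span _ (Set.mem_insert _ _)
  · exact Q.isSubspace_span _ y (Q.subset_span _ (Set.mem_insert _ _)) s
      (Q.subset_span _ (Set.mem_insert_of_mem _ hs)) (by rintro rfl; exact hyA hs) L hL hyL hsL haL

theorem span_insert_eq_of_mem (hQ : Q.IsPolarSpace) {A : Set P} {a y : P}
    (hA : Q.IsSingular A) (ha : ∀ s ∈ A, Q.Collinear a s) (hy : y ∈ Q.span (insert a A))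
    (hyA : y ∉ A) : Q.span (insert y A) = Q.span (insert a A) := by
  apply (span_subset (Q.isSubspace_span _) _).antisymm (span_subset (Q.isSubspace_span _) _)
  · exact Set.insert_subset hy ((Set.subset_insert _ _).trans (Q.subset_span _))
  · exact Set.insert_subset (hQ.mem_span_insert_exchange hA ha hy hyA)
      ((Set.subset_insert _ _).trans (Q.subset_span _))

/-- Every line in the span of a singular subspace `A` and a point meets `A`. -/
theorem exists_mem_line_of_subset_span_insert (hQ : Q.IsPolarSpace) {A : Set P} {a : P}
    (hA : Q.IsSingular A) (ha : ∀ s ∈ A, Q.Collinear a s) {L : Set P} (hL : L ∈ Q.lines)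
    (hLA : L ⊆ Q.span (insert a A)) : ∃ z ∈ L, z ∈ A := by
  obtain ⟨t, ht, y, hy, hty⟩ := Q.two_points L hL
  by_cases htA : t ∈ A
  · exact ⟨t, ht, htA⟩
  have hy' := hLA hy
  have hsing := hQ.isSingular_span_insert hA ha
  rw [← hQ.span_insert_eq_of_mem hA ha (hLA ht) htA] at hy'
  obtain rfl | ⟨s, hs, K, hK, htK, hsK, hyK⟩ := hQ.mem_span_insert hA
    (fun s hs => hsing.2 t (hLA ht) s (Q.subset_span _ (Set.mem_insert_of_mem _ hs))) hy'
  · exact absurd rfl hty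
  · obtain rfl := Q.line_unique _ _ hty L hL K hK ht hy htK hyK
    exact ⟨s, hsK, hs⟩

end IsPolarSpace

/-- A subspace `H` of a singular subspace `T` that meets all lines of `T` is `T` or a hyperplane. -/
theorem IsSingular.span_insert_eq {H T : Set P} (hT : Q.IsSingular T) (hHT : H ⊆ T)
    (hline : ∀ L ∈ Q.lines, L ⊆ T → ∃ z ∈ L, z ∈ H) {t : P} (ht : t ∈ T) (htH : t ∉ H) :
    Q.span (insert t H) = T := by
  apply (span_subset hT.1 (Set.insert_subset ht hHT)).antisymm
  intro y hy
  by_cases hty : t = y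
  · subst hty
    exact Q.subset_span _ (Set.mem_insert _ _)
  obtain ⟨L, hL, htL, hyL⟩ := hT.2 t ht y hy
  obtain ⟨z, hzL, hzH⟩ := hline L hL (hT.1 t ht y hy hty L hL htL hyL)
  exact Q.isSubspace_span _ t (Q.subset_span _ (Set.mem_insert _ _)) z
    (Q.subset_span _ (Set.mem_insert_of_mem _ hzH)) (by rintro rfl; exact htH hzH) L hL htL hzL hyL

end PartialLinearSpace

/-! ### Separation by perps, and the rank of singular subspaces -/

namespace PartialLinearSpace

variable {P : Type*} {Q : PartialLinearSpace P}

open Classical in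
/-- If `f` is not in the span of a finite set `E` of pairwise collinear points, then some point is
collinear with all points of `E`, but not with `f`. -/
theorem IsPolarSpace.exists_perp_not_collinear (hQ : Q.IsPolarSpace) (E : Finset P) (f : P)
    (hE : ∀ x ∈ E, ∀ y ∈ E, Q.Collinear x y) (hf : ∀ x ∈ E, Q.Collinear f x)
    (hfE : f ∉ Q.span (E : Set P)) : ∃ x, (∀ e ∈ E, Q.Collinear x e) ∧ ¬ Q.Collinear x f := by
  induction hk : E.card using Nat.strong_induction_on generalizing E f with
  | _ k ih =>
  subst hk
  obtain rfl | ⟨b, hb⟩ := E.eq_empty_or_nonempty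
  · obtain ⟨x, hx⟩ := hQ.nondegenerate f
    exact ⟨x, by simp, fun h => hx h.symm⟩
  obtain ⟨F, hbF, rfl⟩ : ∃ F, b ∉ F ∧ E = insert b F :=
    ⟨E.erase b, by simp, (Finset.insert_erase hb).symm⟩
  obtain rfl | ⟨c, hc⟩ := F.eq_empty_or_nonempty
  · obtain ⟨x, h1, h2⟩ := hQ.exists_collinear_not_collinear (p := b) (q := f)
      (by rintro rfl; exact hfE (Q.subset_span _ (by simp)))
    exact ⟨x, by simpa using h1.symm, fun h => h2 h.symm⟩
  obtain ⟨G, hcG, rfl⟩ : ∃ G, c ∉ G ∧ F = insert c G :=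
    ⟨F.erase c, by simp, (Finset.insert_erase hc).symm⟩
  have hbc : b ≠ c := by rintro rfl; simp at hbF
  have hbG : b ∉ G := fun h => hbF (Finset.mem_insert_of_mem h)
  have hcard : (insert b (insert c G)).card = G.card + 2 := by
    rw [Finset.card_insert_of_notMem hbF, Finset.card_insert_of_notMem hcG]
  have hGE : ∀ x ∈ G, x ∈ insert b (insert c G) := fun x hx => by simp [hx]
  have hcE : c ∈ insert b (insert c G) := by simp
  have hGsing : Q.IsSingular (Q.span (G : Set P)) :=
    hQ.isSingular_span fun x hx y hy => hE x (hGE x hx) y (hGE y hy)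
  have hspan : Q.span (G : Set P) ⊆ Q.span ((insert b (insert c G) : Finset P) : Set P) :=
    span_mono fun x hx => hGE x hx
  obtain ⟨K, hK, hbK, hcK⟩ := hE b hb c hcE
  have hKE : K ⊆ Q.span ((insert b (insert c G) : Finset P) : Set P) :=
    Q.isSubspace_span _ b (Q.subset_span _ hb) c (Q.subset_span _ hcE) hbc K hK hbK hcK
  by_cases hbspan : b ∈ Q.span (G : Set P)
  · obtain ⟨x, hx, hxf⟩ := ih (insert c G).card
      (by rw [hcard, Finset.card_insert_of_notMem hcG]; omega) (insert c G) f
      (fun x hx y hy => hE x (Finset.mem_insert_of_mem hx) y (Finset.mem_insert_of_mem hy))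
      (fun x hx => hf x (Finset.mem_insert_of_mem hx))
      (fun h => hfE (span_mono (fun y hy => Finset.mem_insert_of_mem hy) h)) rfl
    refine ⟨x, fun e he => ?_, hxf⟩
    obtain rfl | he := Finset.mem_insert.1 he
    · exact hQ.collinear_span (fun y hy => hx y (Finset.mem_insert_of_mem hy)) _ hbspan
    · exact hx e he
  -- The induction hypothesis is applied to `insert f G` and to `insert u G` with `u` on the line
  -- `bc`; both have fewer points than `insert b (insert c G)`. In the first case, `b` is outside
  -- the span by exchange.
  obtain ⟨x, h1, h2, h3, h4⟩ := hQ.exists_perp_pair_of_perp (E := (G : Set P)) hK hbK hcK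
    (fun h => hfE (hKE h)) (hf b hb) (hf c hcE) (fun e he => hf e (hGE e he))
    (by
      obtain ⟨t, ht, htb⟩ := ih (insert f G).card
        ((Finset.card_insert_le _ _).trans_lt (by omega)) (insert f G) b
        (by
          intro x hx y hy
          obtain rfl | hx' := Finset.mem_insert.1 hx <;> obtain rfl | hy' := Finset.mem_insert.1 hy
          · exact Q.collinear_refl _
          · exact hf y (hGE y hy')
          · exact (hf x (hGE x hx')).symm
          · exact hE x (hGE x hx') y (hGE y hy'))
        (by
          intro x hx
          obtain rfl | hx := Finset.mem_insert.1 hx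
          · exact (hf b hb).symm
          · exact hE b hb x (hGE x hx))
        (by
          intro h
          rw [Finset.coe_insert, ← span_insert_span] at h
          have h' := hQ.mem_span_insert_exchange hGsing
            (hQ.collinear_span fun e he => hf e (hGE e he)) h hbspan
          rw [span_insert_span] at h'
          refine hfE (span_mono ?_ h')
          rintro y (rfl | hy)
          · exact hb
          · exact hGE y hy) rfl
      exact ⟨t, fun e he => ht e (Finset.mem_insert_of_mem he),
        ht f (Finset.mem_insert_self _ _), htb⟩)
    (by
      intro u hu
      have huE := hKE hu
      obtain ⟨t, ht, htb⟩ := ih (insert u G).card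
        ((Finset.card_insert_le _ _).trans_lt (by omega)) (insert u G) f
        (by
          have := (hQ.isSingular_span hE).2
          have hG' : ∀ x ∈ insert u G, x ∈ Q.span ((insert b (insert c G) : Finset P) : Set P) := by
            intro x hx
            obtain rfl | hx := Finset.mem_insert.1 hx
            · exact huE
            · exact hspan (Q.subset_span _ hx)
          exact fun x hx y hy => this x (hG' x hx) y (hG' y hy))
        (by
          intro x hx
          obtain rfl | hx := Finset.mem_insert.1 hx
          · exact hQ.collinear_span hf x huE
          · exact hf x (hGE x hx))
        (by
          intro h
          refine hfE (span_subset (Q.isSubspace_span _) ?_ h)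
          intro y hy
          obtain rfl | hy := Finset.mem_insert.1 (Finset.mem_coe.1 hy)
          · exact huE
          · exact hspan (Q.subset_span _ hy)) rfl
      exact ⟨t, fun e he => ht e (Finset.mem_insert_of_mem he),
        ht u (Finset.mem_insert_self _ _), htb⟩)
  refine ⟨x, fun e he => ?_, h4⟩
  simp only [Finset.mem_insert] at he
  obtain rfl | rfl | he := he
  · exact h2
  · exact h3
  · exact h1 e he

/-- The smallest cardinality of a finite set spanning `S`. -/
noncomputable def rk (Q : PartialLinearSpace P) (S : Set P) : ℕ :=
  sInf {k | ∃ X : Finset P, X.card = k ∧ Q.span (X : Set P) = S}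

theorem rk_span_le (X : Finset P) : Q.rk (Q.span (X : Set P)) ≤ X.card :=
  Nat.sInf_le ⟨X, rfl, rfl⟩

theorem rk_empty (Q : PartialLinearSpace P) : Q.rk ∅ = 0 := by
  have h := rk_span_le (Q := Q) (∅ : Finset P)
  rw [Finset.coe_empty, Q.isSubspace_empty.span_eq] at h
  simpa using h

namespace IsPolarSpace

theorem wellFounded_singular (hQ : Q.IsPolarSpace) :
    WellFounded fun S T : {S : Set P // Q.IsSingular S} => T < S := by
  rw [RelEmbedding.wellFounded_iff_isEmpty]
  refine ⟨fun e => ?_⟩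
  have hmono : StrictMono fun k => (e k : Set P) :=
    strictMono_nat_of_lt_succ fun k => e.map_rel_iff.2 (Nat.lt_succ_self k)
  refine Set.infinite_range_of_injective hmono.injective (hQ.finite_flags _ ?_ ?_)
  · rintro _ ⟨k, rfl⟩
    exact (e k).2
  · rintro _ ⟨k, rfl⟩ _ ⟨l, rfl⟩ -
    exact (le_total k l).imp (fun h => hmono.monotone h) fun h => hmono.monotone h

/-- A singular subspace is obtained from a smaller one by adding points one after the other. -/
theorem singular_induction (hQ : Q.IsPolarSpace) {T S : Set P} (hT : Q.IsSubspace T)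
    (hS : Q.IsSingular S) (hTS : T ⊆ S) {p : Set P → Prop} (base : p T)
    (step : ∀ A, Q.IsSingular A → T ⊆ A → A ⊆ S → p A → ∀ a ∈ S, a ∉ A →
      (∀ s ∈ A, Q.Collinear a s) → p (Q.span (insert a A))) : p S := by
  -- The well-founded relation is reversed inclusion, so a minimal element is a largest subspace
  -- between `T` and `S` with the property.
  obtain ⟨A, ⟨hTA, hAS, hA⟩, hmin⟩ := hQ.wellFounded_singular.has_min
    {A | T ⊆ A.1 ∧ A.1 ⊆ S ∧ p A.1} ⟨⟨T, hS.mono hT hTS⟩, subset_rfl, hTS, base⟩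
  by_cases h : S ⊆ A.1
  · rwa [← hAS.antisymm h]
  exfalso
  obtain ⟨a, haS, haA⟩ := Set.not_subset.1 h
  have ha : ∀ s ∈ A.1, Q.Collinear a s := fun s hs => hS.2 a haS s (hAS hs)
  have hsub : A.1 ⊆ Q.span (insert a A.1) := (Set.subset_insert _ _).trans (Q.subset_span _)
  refine hmin ⟨Q.span (insert a A.1), hQ.isSingular_span_insert A.2 ha⟩
    ⟨hTA.trans hsub, span_subset hS.1 (Set.insert_subset haS hAS),
      step A.1 A.2 hTA hAS hA a haS haA ha⟩ ⟨hsub, fun h' => haA ?_⟩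
  exact h' (Q.subset_span _ (Set.mem_insert _ _))

open Classical in
-- Finiteness of flags bounds the process of adding points. Thus for singular subspaces `rk` is
-- attained and is never the default value `sInf ∅ = 0`.
theorem exists_finset_span_eq (hQ : Q.IsPolarSpace) {S : Set P} (hS : Q.IsSingular S) :
    ∃ X : Finset P, X.card = Q.rk S ∧ Q.span (X : Set P) = S := by
  have h : ∃ X : Finset P, Q.span (X : Set P) = S := by
    refine hQ.singular_induction (p := fun S => ∃ X : Finset P, Q.span (X : Set P) = S)
      Q.isSubspace_empty hS (Set.empty_subset _)
      ⟨∅, by rw [Finset.coe_empty, Q.isSubspace_empty.span_eq]⟩ ?_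
    rintro A - - - ⟨X, rfl⟩ a - - -
    exact ⟨insert a X, by rw [Finset.coe_insert, span_insert_span]⟩
  obtain ⟨X, hX⟩ := h
  exact Nat.sInf_mem (s := {k | ∃ X : Finset P, X.card = k ∧ Q.span (X : Set P) = S})
    ⟨X.card, X, rfl, hX⟩

open Classical in
-- Induction on `X`: dropping `x` leaves a subspace `H` that meets every line of the span. If `T` is
-- not inside `H`, then `T ∩ H` is a proper subspace of `H`, and a single further point of `T`
-- generates `T` from it. This is the source of the strict monotonicity of `rk`.
theorem exists_finset_card_lt (hQ : Q.IsPolarSpace) (X : Finset P) :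
    ∀ T, Q.IsSubspace T → Q.IsSingular (Q.span (X : Set P)) → T ⊂ Q.span (X : Set P) →
      ∃ Y : Finset P, Q.span (Y : Set P) = T ∧ Y.card < X.card := by
  induction X using Finset.induction with
  | empty =>
    intro T _ _ h
    rw [Finset.coe_empty, Q.isSubspace_empty.span_eq] at h
    exact absurd (Set.empty_subset T) h.2
  | insert x X hx ih =>
    intro T hT hS h
    have hXS : Q.span (X : Set P) ⊆ Q.span ((insert x X : Finset P) : Set P) :=
      span_mono (by simp)
    have hX := hS.mono (Q.isSubspace_span _) hXS
    rw [Finset.card_insert_of_notMem hx]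
    have hxS : x ∈ Q.span ((insert x X : Finset P) : Set P) := Q.subset_span _ (by simp)
    have hxX : ∀ s ∈ Q.span (X : Set P), Q.Collinear x s := fun s hs => hS.2 x hxS s (hXS hs)
    by_cases hTX : T ⊆ Q.span (X : Set P)
    · rcases hTX.eq_or_ssubset with rfl | hlt
      · exact ⟨X, rfl, by omega⟩
      · obtain ⟨Y, hY, hc⟩ := ih T hT hX hlt
        exact ⟨Y, hY, by omega⟩
    obtain ⟨t, ht, htX⟩ := Set.not_subset.1 hTX
    have hS' : Q.span ((insert x X : Finset P) : Set P) =
        Q.span (insert x (Q.span (X : Set P))) := by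
      rw [Finset.coe_insert, span_insert_span]
    have hproper : T ∩ Q.span (X : Set P) ⊂ Q.span (X : Set P) := by
      refine Set.inter_subset_right.ssubset_of_ne fun heq => h.2 ?_
      rw [hS', ← hQ.span_insert_eq_of_mem hX hxX (hS' ▸ h.1 ht) htX]
      exact span_subset hT (Set.insert_subset ht (Set.inter_eq_right.1 heq))
    obtain ⟨Y, hY, hc⟩ := ih _ (hT.inter hX.1) hX hproper
    refine ⟨insert t Y, ?_, (Finset.card_insert_le _ _).trans_lt (by omega)⟩
    rw [Finset.coe_insert, ← span_insert_span, hY]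
    refine (hS.mono hT h.1).span_insert_eq Set.inter_subset_left ?_ ht fun h' => htX h'.2
    intro L hL hLT
    obtain ⟨z, hzL, hz⟩ := hQ.exists_mem_line_of_subset_span_insert hX hxX hL
      (hS' ▸ hLT.trans h.1)
    exact ⟨z, hzL, hLT hzL, hz⟩

theorem rk_lt_of_ssubset (hQ : Q.IsPolarSpace) {S T : Set P} (hS : Q.IsSingular S)
    (hT : Q.IsSubspace T) (h : T ⊂ S) : Q.rk T < Q.rk S := by
  obtain ⟨X, hc, rfl⟩ := hQ.exists_finset_span_eq hS
  obtain ⟨Y, rfl, hY⟩ := hQ.exists_finset_card_lt X T hT hS h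
  exact (rk_span_le Y).trans_lt (hc ▸ hY)

theorem rk_le_of_subset (hQ : Q.IsPolarSpace) {S T : Set P} (hS : Q.IsSingular S)
    (hT : Q.IsSubspace T) (h : T ⊆ S) : Q.rk T ≤ Q.rk S := by
  rcases h.eq_or_ssubset with rfl | h
  · exact le_rfl
  · exact (hQ.rk_lt_of_ssubset hS hT h).le

theorem eq_of_subset_of_rk_le (hQ : Q.IsPolarSpace) {S T : Set P} (hS : Q.IsSingular S)
    (hT : Q.IsSubspace T) (h : T ⊆ S) (hrk : Q.rk S ≤ Q.rk T) : T = S := by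
  rcases h.eq_or_ssubset with rfl | h
  · rfl
  · exact absurd (hQ.rk_lt_of_ssubset hS hT h) (by omega)

open Classical in
theorem rk_span_insert_le (hQ : Q.IsPolarSpace) {A : Set P} (hA : Q.IsSingular A) (a : P) :
    Q.rk (Q.span (insert a A)) ≤ Q.rk A + 1 := by
  obtain ⟨X, hc, rfl⟩ := hQ.exists_finset_span_eq hA
  rw [span_insert_span, ← Finset.coe_insert, ← hc]
  exact (rk_span_le _).trans (Finset.card_insert_le _ _)

theorem rk_span_insert (hQ : Q.IsPolarSpace) {A : Set P} {a : P} (hA : Q.IsSingular A)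
    (ha : ∀ s ∈ A, Q.Collinear a s) (haA : a ∉ A) :
    Q.rk (Q.span (insert a A)) = Q.rk A + 1 := by
  refine (hQ.rk_span_insert_le hA a).antisymm (hQ.rk_lt_of_ssubset
    (hQ.isSingular_span_insert hA ha) hA.1
    ⟨(Set.subset_insert _ _).trans (Q.subset_span _), fun h => haA ?_⟩)
  exact h (Q.subset_span _ (Set.mem_insert _ _))

theorem rk_le_of_meets_lines (hQ : Q.IsPolarSpace) {H T : Set P} (hT : Q.IsSingular T)
    (hH : Q.IsSubspace H) (hHT : H ⊆ T)
    (hline : ∀ L ∈ Q.lines, L ⊆ T → ∃ z ∈ L, z ∈ H) : Q.rk T ≤ Q.rk H + 1 := by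
  rcases hHT.eq_or_ssubset with rfl | h
  · omega
  obtain ⟨t, ht, htH⟩ := Set.exists_of_ssubset h
  rw [← hT.span_insert_eq hHT hline ht htH]
  exact hQ.rk_span_insert_le (hT.mono hH hHT) t

theorem rk_le_rk_inter_perp (hQ : Q.IsPolarSpace) {T : Set P} (hT : Q.IsSingular T) (x : P) :
    Q.rk T ≤ Q.rk (T ∩ Q.perp {x}) + 1 := by
  refine hQ.rk_le_of_meets_lines hT (hT.1.inter (hQ.isSubspace_perp _)) Set.inter_subset_left ?_
  intro L hL hLT
  obtain ⟨z, hz, hxz⟩ := hQ.exists_collinear_mem_line x hL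
  exact ⟨z, hz, hLT hz, by rintro _ rfl; exact hxz.symm⟩

/-- The modular inequality for subspaces of a singular subspace. -/
theorem rk_add_rk_le (hQ : Q.IsPolarSpace) {W A B : Set P} (hW : Q.IsSingular W)
    (hA : Q.IsSubspace A) (hB : Q.IsSubspace B) (hAW : A ⊆ W) (hBW : B ⊆ W) :
    Q.rk A + Q.rk B ≤ Q.rk W + Q.rk (A ∩ B) := by
  have h : Q.rk A + Q.rk (W ∩ B) ≤ Q.rk W + Q.rk (A ∩ B) := by
    refine hQ.singular_induction (p := fun C => Q.rk A + Q.rk (C ∩ B) ≤ Q.rk C + Q.rk (A ∩ B))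
      hA hW hAW le_rfl ?_
    intro C hC hAC hCW hle c hcW hcC hc
    rw [hQ.rk_span_insert hC hc hcC]
    have hD := hQ.isSingular_span_insert hC hc
    have hCD : C ⊆ Q.span (insert c C) := (Set.subset_insert _ _).trans (Q.subset_span _)
    -- Adding `c` raises the rank of `C` by exactly one and that of `C ∩ B` by at most one.
    have := hQ.rk_le_of_meets_lines (H := C ∩ B) (T := Q.span (insert c C) ∩ B)
      (hD.mono (hD.1.inter hB) Set.inter_subset_left) (hC.1.inter hB)
      (Set.inter_subset_inter_left _ hCD)
      (by
        intro L hL hLT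
        obtain ⟨z, hzL, hz⟩ := hQ.exists_mem_line_of_subset_span_insert hC hc hL
          (hLT.trans Set.inter_subset_left)
        exact ⟨z, hzL, hz, (hLT hzL).2⟩)
    omega
  rwa [Set.inter_eq_right.2 hBW] at h

/-- Build `S` from `S ∩ U` point by point: each new point costs `U ∩ Q.perp A` at most one unit of
rank. For maximal `S` the final intersection is `S ∩ U`, which gives `rk U ≤ rk S`. -/
theorem rk_add_rk_inter_le (hQ : Q.IsPolarSpace) {S U : Set P} (hS : Q.IsSingular S)
    (hU : Q.IsSingular U) :
    Q.rk U + Q.rk (S ∩ U) ≤ Q.rk (U ∩ Q.perp S) + Q.rk S := by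
  refine hQ.singular_induction (p := fun A => Q.rk U + Q.rk (S ∩ U) ≤
    Q.rk (U ∩ Q.perp A) + Q.rk A) (hS.1.inter hU.1) hS Set.inter_subset_left ?_ ?_
  · have h : U ∩ Q.perp (S ∩ U) = U :=
      Set.inter_eq_left.2 fun u hu x hx => hU.2 u hu x hx.2
    rw [h]
  · intro A hA _ _ hle a _ haA ha
    rw [hQ.rk_span_insert hA ha haA]
    have h := hQ.rk_le_rk_inter_perp
      (hU.mono (hU.1.inter (hQ.isSubspace_perp A)) Set.inter_subset_left) a
    have h' : U ∩ Q.perp A ∩ Q.perp {a} = U ∩ Q.perp (Q.span (insert a A)) := by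
      ext y
      constructor
      · rintro ⟨⟨hyU, hyA⟩, hya⟩
        refine ⟨hyU, hQ.collinear_span ?_⟩
        rintro x (rfl | hx)
        · exact hya _ rfl
        · exact hyA x hx
      · rintro ⟨hyU, hy⟩
        refine ⟨⟨hyU, fun x hx => hy x (Q.subset_span _ (Set.mem_insert_of_mem _ hx))⟩, ?_⟩
        rintro _ rfl
        exact hy _ (Q.subset_span _ (Set.mem_insert _ _))
    rw [h'] at h
    omega

theorem mem_of_isMaximalSingular (hQ : Q.IsPolarSpace) {S : Set P} (hS : Q.IsMaximalSingular S)
    {x : P} (hx : ∀ s ∈ S, Q.Collinear x s) : x ∈ S :=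
  hS.2 (hQ.isSingular_span_insert hS.1 hx)
    ((Set.subset_insert _ _).trans (Q.subset_span _)) (Q.subset_span _ (Set.mem_insert _ _))

/-- The rank of a singular subspace is at most the rank of a maximal one. -/
theorem rk_le_rk_of_isMaximalSingular (hQ : Q.IsPolarSpace) {S U : Set P}
    (hS : Q.IsMaximalSingular S) (hU : Q.IsSingular U) : Q.rk U ≤ Q.rk S := by
  have h := hQ.rk_add_rk_inter_le hS.1 hU
  have h' : U ∩ Q.perp S = S ∩ U := by
    ext y
    exact ⟨fun hy => ⟨hQ.mem_of_isMaximalSingular hS hy.2, hy.1⟩,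
      fun hy => ⟨hy.2, hS.1.2 y hy.1⟩⟩
  rw [h'] at h
  omega

/-- A spanning set of least cardinality is automatically independent, so requiring bases rather than
spanning sets does not change the minimum. -/
theorem hasDim_iff (hQ : Q.IsPolarSpace) {S : Set P} (hS : Q.IsSingular S) {d : ℤ} :
    Q.HasDim S d ↔ (Q.rk S : ℤ) = d + 1 := by
  have key : Q.HasDim S ((Q.rk S : ℤ) - 1) := by
    obtain ⟨X, hc, hX⟩ := hQ.exists_finset_span_eq hS
    refine ⟨⟨X, ⟨hX ▸ Q.subset_span _, ?_, hX⟩, by rw [hc]⟩, ?_⟩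
    · intro Y hY heq
      have hfin : Y.Finite := X.finite_toSet.subset hY.1
      lift Y to Finset P using hfin
      have h1 := rk_span_le (Q := Q) Y
      rw [heq, hX, ← hc] at h1
      have := Finset.card_lt_card (Finset.coe_ssubset.1 hY)
      omega
    · rintro k ⟨Y, ⟨-, -, hY⟩, rfl⟩
      have := rk_span_le (Q := Q) Y
      rw [hY] at this
      omega
  constructor
  · intro h
    have := h.unique key
    omega
  · intro h
    rwa [h, add_sub_cancel_right] at key

section Rank

variable {n : ℕ}

theorem rk_le_rank (hQ : Q.IsPolarSpace) (hn : Q.HasRank n) {S : Set P} (hS : Q.IsSingular S) :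
    Q.rk S ≤ n := by
  obtain ⟨T, hT, hd⟩ := hn
  have h1 := (hQ.hasDim_iff hT.1).1 hd
  have h2 := hQ.rk_le_rk_of_isMaximalSingular hT hS
  omega

theorem isMaximalSingular_iff (hQ : Q.IsPolarSpace) (hn : Q.HasRank n) {S : Set P} :
    Q.IsMaximalSingular S ↔ Q.IsSingular S ∧ Q.rk S = n := by
  constructor
  · intro h
    refine ⟨h.1, (hQ.rk_le_rank hn h.1).antisymm ?_⟩
    obtain ⟨T, hT, hd⟩ := hn
    have h1 := (hQ.hasDim_iff hT.1).1 hd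
    have h2 := hQ.rk_le_rk_of_isMaximalSingular h hT.1
    omega
  · rintro ⟨hS, hrk⟩
    refine ⟨hS, fun T hT hST => ?_⟩
    rw [hQ.eq_of_subset_of_rk_le hT hS.1 hST ((hQ.rk_le_rank hn hT).trans hrk.ge)]

theorem mem_grassmannian_iff (hQ : Q.IsPolarSpace) {S : Set P} {k : ℤ} :
    S ∈ Q.grassmannian k ↔ Q.IsSingular S ∧ (Q.rk S : ℤ) = k + 1 :=
  and_congr_right fun h => hQ.hasDim_iff h

theorem mem_grassmannian_iff_isMaximalSingular (hQ : Q.IsPolarSpace) (hn : Q.HasRank n)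
    {S : Set P} : S ∈ Q.grassmannian ((n : ℤ) - 1) ↔ Q.IsMaximalSingular S := by
  rw [hQ.mem_grassmannian_iff, hQ.isMaximalSingular_iff hn]
  refine and_congr_right fun _ => ?_
  omega

end Rank

end IsPolarSpace

end PartialLinearSpace

/-! ### Distances in the hypercube and in the dual polar graph -/

/-- A function that drops by at most one along each edge is a lower bound for the length of walks;
one that can always be decreased along some edge produces a walk of at most that length. -/
theorem SimpleGraph.edist_eq_natCast {V : Type*} (G : SimpleGraph V) (D : V → V → ℕ)
    (hself : ∀ v, D v v = 0) (hadj : ∀ u v w, G.Adj u v → D u w ≤ D v w + 1)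
    (heq : ∀ u w, D u w = 0 → u = w)
    (hstep : ∀ u w, D u w ≠ 0 → ∃ v, G.Adj u v ∧ D v w < D u w) (u w : V) :
    G.edist u w = D u w := by
  apply le_antisymm
  · have h : ∀ k u, D u w ≤ k → ∃ p : G.Walk u w, p.length ≤ k := by
      intro k
      induction k with
      | zero =>
        intro u hu
        obtain rfl := heq u w (by omega)
        exact ⟨.nil, le_rfl⟩
      | succ k ih =>
        intro u hu
        by_cases h0 : D u w = 0
        · obtain rfl := heq u w h0
          exact ⟨.nil, by simp⟩
        obtain ⟨v, hv, hlt⟩ := hstep u w h0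
        obtain ⟨p, hp⟩ := ih v (by omega)
        exact ⟨.cons hv p, by simpa using hp⟩
    obtain ⟨p, hp⟩ := h _ u le_rfl
    exact (SimpleGraph.edist_le p).trans (by exact_mod_cast hp)
  · refine le_iInf fun p => ?_
    have h : D u w ≤ p.length := by
      induction p with
      | nil => simp [hself]
      | cons h p ih =>
        have := hadj _ _ (by assumption) h
        rw [SimpleGraph.Walk.length_cons]
        omega
    exact_mod_cast h

theorem hammingDist_update_self {ι β : Type*} [Fintype ι] [DecidableEq ι] [DecidableEq β]
    (v : ι → β) (i : ι) {b : β} (hb : b ≠ v i) : hammingDist (Function.update v i b) v = 1 := by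
  rw [hammingDist, Finset.card_eq_one]
  refine ⟨i, ?_⟩
  ext j
  by_cases hj : j = i
  · subst hj; simp [hb]
  · simp [hj]

theorem hammingDist_add_of_between {ι β : Type*} [Fintype ι] [DecidableEq β] {u v w : ι → β}
    (h : ∀ i, u i = v i ∨ u i = w i) : hammingDist v u + hammingDist u w = hammingDist v w := by
  simp only [hammingDist, Finset.card_filter, ← Finset.sum_add_distrib]
  refine Finset.sum_congr rfl fun i _ => ?_
  obtain h | h := h i <;> simp [h]

theorem hammingDist_not_right {ι : Type*} [Fintype ι] (v : ι → Bool) :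
    hammingDist v (fun i => !v i) = Fintype.card ι := by
  simp [hammingDist]

theorem hypercubeGraph_adj_iff {m : ℕ} {v w : Fin m → Bool} :
    (hypercubeGraph m).Adj v w ↔ hammingDist v w = 1 := by
  rw [hammingDist, Finset.card_eq_one]
  simp only [hypercubeGraph, ExistsUnique, Finset.ext_iff, Finset.mem_filter, Finset.mem_univ,
    true_and, Finset.mem_singleton]
  refine exists_congr fun i => ⟨fun h j => ⟨h.2 j, fun hj => hj ▸ h.1⟩, fun h =>
    ⟨(h i).2 rfl, fun j => (h j).1⟩⟩

theorem hypercubeGraph_edist {m : ℕ} (v w : Fin m → Bool) :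
    (hypercubeGraph m).edist v w = hammingDist v w := by
  apply SimpleGraph.edist_eq_natCast (D := hammingDist)
  · exact hammingDist_self
  · intro u v w h
    have := hammingDist_triangle u v w
    rw [hypercubeGraph_adj_iff.1 h] at this
    omega
  · exact fun u w => eq_of_hammingDist_eq_zero
  · intro u w h
    obtain ⟨i, hi⟩ := Function.ne_iff.1 (hammingDist_ne_zero.1 h)
    have h1 := hammingDist_update_self u i (b := w i) hi.symm
    refine ⟨Function.update u i (w i), hypercubeGraph_adj_iff.2 (by rw [hammingDist_comm, h1]), ?_⟩
    have h2 := hammingDist_add_of_between (u := Function.update u i (w i)) (v := u) (w := w)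
      (by
        intro j
        by_cases hj : j = i
        · subst hj; simp
        · simp [hj])
    rw [hammingDist_comm u, h1] at h2
    omega

namespace PartialLinearSpace

variable {P : Type*} {Q : PartialLinearSpace P}

namespace IsPolarSpace

theorem dualPolarGraph_adj_iff (hQ : Q.IsPolarSpace) {n : ℕ}
    {S U : Q.grassmannian ((n : ℤ) - 1)} :
    (Q.dualPolarGraph n).Adj S U ↔ Q.rk (S ∩ U : Set P) + 1 = n := by
  change Q.HasDim (S ∩ U : Set P) ((n : ℤ) - 2) ↔ _
  rw [hQ.hasDim_iff (S.2.1.mono (S.2.1.1.inter U.2.1.1) Set.inter_subset_left)]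
  omega

/-- The distance in the dual polar graph. -/
theorem dualPolarGraph_edist (hQ : Q.IsPolarSpace) {n : ℕ} (hn : Q.HasRank n)
    (S U : Q.grassmannian ((n : ℤ) - 1)) :
    (Q.dualPolarGraph n).edist S U = (n - Q.rk (S ∩ U : Set P) : ℕ) := by
  have hrk : ∀ S : Q.grassmannian ((n : ℤ) - 1), Q.rk (S : Set P) = n := fun S =>
    ((hQ.isMaximalSingular_iff hn).1
      ((hQ.mem_grassmannian_iff_isMaximalSingular hn).1 S.2)).2
  have hinter : ∀ S U : Q.grassmannian ((n : ℤ) - 1), Q.IsSingular (S ∩ U : Set P) := fun S U =>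
    S.2.1.mono (S.2.1.1.inter U.2.1.1) Set.inter_subset_left
  have heq : ∀ S U : Q.grassmannian ((n : ℤ) - 1), n ≤ Q.rk (S ∩ U : Set P) → S = U := by
    intro S U h
    have h1 := hQ.eq_of_subset_of_rk_le S.2.1 (hinter S U).1 Set.inter_subset_left
      (by rw [hrk]; omega)
    have h2 := hQ.eq_of_subset_of_rk_le U.2.1 (hinter S U).1 Set.inter_subset_right
      (by rw [hrk]; omega)
    exact Subtype.ext (h1.symm.trans h2)
  apply SimpleGraph.edist_eq_natCast
    (D := fun S U : Q.grassmannian ((n : ℤ) - 1) => n - Q.rk (S ∩ U : Set P))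
  · intro S
    simp [hrk]
  -- The modular inequality in `T`: since `S ∩ T` has rank `n - 1`, passing from `T ∩ U` to `S ∩ U`
  -- loses at most one.
  · intro S T U h
    rw [hQ.dualPolarGraph_adj_iff] at h
    have h1 := hQ.rk_add_rk_le T.2.1 (hinter S T).1 (hinter T U).1 Set.inter_subset_right
      Set.inter_subset_left
    have h2 : Q.rk (S ∩ T ∩ (T ∩ U) : Set P) ≤ Q.rk (S ∩ U : Set P) :=
      hQ.rk_le_of_subset (hinter S U) ((hinter S T).1.inter (hinter T U).1)
        fun x hx => ⟨hx.1.1, hx.2.2⟩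
    rw [hrk] at h1
    omega
  · intro S U h
    exact heq S U (by omega)
  · intro S U h
    have hlt : Q.rk (S ∩ U : Set P) < n := by omega
    have hUS : ¬ (U : Set P) ⊆ S := by
      intro hsub
      rw [Set.inter_eq_right.2 hsub, hrk] at hlt
      omega
    -- The neighbour of `S` nearer to `U` is spanned by a point `p` of `U` outside `S` and the
    -- hyperplane of `S` collinear with `p`; it contains `p` and `S ∩ U`.
    obtain ⟨p, hpU, hpS⟩ := Set.not_subset.1 hUS
    have hH : Q.IsSingular (S ∩ Q.perp {p} : Set P) :=
      S.2.1.mono (S.2.1.1.inter (hQ.isSubspace_perp _)) Set.inter_subset_left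
    have hpH : ∀ s ∈ (S ∩ Q.perp {p} : Set P), Q.Collinear p s := fun s hs => (hs.2 p rfl).symm
    have hHrk := hQ.rk_le_rk_inter_perp S.2.1 p
    rw [hrk] at hHrk
    have hT := hQ.isSingular_span_insert hH hpH
    have hTrk := hQ.rk_span_insert hH hpH (fun h => hpS h.1)
    have hTle := hQ.rk_le_rank hn hT
    have hHT : (S ∩ Q.perp {p} : Set P) ⊆ Q.span (insert p (S ∩ Q.perp {p})) :=
      (Set.subset_insert _ _).trans (Q.subset_span _)
    have hpT : p ∈ Q.span (insert p (S ∩ Q.perp {p} : Set P)) :=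
      Q.subset_span _ (Set.mem_insert _ _)
    let T : Q.grassmannian ((n : ℤ) - 1) := ⟨Q.span (insert p (S ∩ Q.perp {p})),
      hQ.mem_grassmannian_iff.2 ⟨hT, by omega⟩⟩
    refine ⟨T, hQ.dualPolarGraph_adj_iff.2 ?_, ?_⟩
    · have h1 : Q.rk (S ∩ Q.perp {p} : Set P) ≤ Q.rk (S ∩ T : Set P) :=
        hQ.rk_le_of_subset (hinter S T) hH.1 (Set.subset_inter Set.inter_subset_left hHT)
      have h2 : Q.rk (S ∩ T : Set P) < Q.rk (T : Set P) :=
        hQ.rk_lt_of_ssubset T.2.1 (hinter S T).1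
          ⟨Set.inter_subset_right, fun h => hpS (h hpT).1⟩
      rw [hrk] at h2
      omega
    · have hpSU : ∀ s ∈ (S ∩ U : Set P), Q.Collinear p s := fun s hs =>
        U.2.1.2 p hpU s hs.2
      have h1 := hQ.rk_span_insert (hinter S U) hpSU (fun h => hpS h.1)
      have h2 : Q.rk (Q.span (insert p (S ∩ U : Set P))) ≤ Q.rk (T ∩ U : Set P) := by
        refine hQ.rk_le_of_subset (hinter T U) (Q.isSubspace_span _)
          (span_subset (hinter T U).1 (Set.insert_subset ⟨hpT, hpU⟩ fun s hs => ⟨?_, hs.2⟩))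
        exact hHT ⟨hs.1, by rintro _ rfl; exact (hpSU s hs).symm⟩
      omega

theorem isIsometricEmbedding_iff (hQ : Q.IsPolarSpace) {n m : ℕ} (hn : Q.HasRank n)
    (f : (Fin m → Bool) → Q.grassmannian ((n : ℤ) - 1)) :
    IsIsometricEmbedding (hypercubeGraph m) (Q.dualPolarGraph n) f ↔
      ∀ v w, Q.rk (f v ∩ f w : Set P) + hammingDist v w = n := by
  have hle : ∀ v w, Q.rk (f v ∩ f w : Set P) ≤ n := fun v w =>
    hQ.rk_le_rank hn ((f v).2.1.mono ((f v).2.1.1.inter (f w).2.1.1) Set.inter_subset_left)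
  simp only [IsIsometricEmbedding, hQ.dualPolarGraph_edist hn, hypercubeGraph_edist,
    Nat.cast_inj]
  constructor
  · rintro ⟨-, h⟩ v w
    have := h v w
    have := hle v w
    omega
  · intro h
    refine ⟨fun v w hvw => ?_, fun v w => ?_⟩
    · have h1 := h v w
      have h2 := h v v
      rw [hammingDist_self] at h2
      rw [← hvw] at h1
      exact eq_of_hammingDist_eq_zero (by omega)
    · have := h v w
      omega

/-- A dual family shows that the points of a family are independent over `A`. -/
theorem rk_span_union_image (hQ : Q.IsPolarSpace) {ι : Type*} {A : Set P} (hA : Q.IsSingular A)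
    (x y : ι → P) (D : Finset ι) (hxA : ∀ i ∈ D, ∀ s ∈ A, Q.Collinear (x i) s)
    (hyA : ∀ i ∈ D, ∀ s ∈ A, Q.Collinear (y i) s)
    (hxx : ∀ i ∈ D, ∀ j ∈ D, Q.Collinear (x i) (x j))
    (hyx : ∀ i ∈ D, ∀ j ∈ D, Q.Collinear (y i) (x j) ↔ i ≠ j) :
    Q.rk (Q.span (A ∪ x '' D)) = Q.rk A + D.card := by
  classical
  induction D using Finset.induction with
  | empty => simp [hA.1.span_eq]
  | insert i D hi ih =>
    have hm : ∀ j ∈ D, j ∈ insert i D := fun j hj => Finset.mem_insert_of_mem hj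
    have hi' := Finset.mem_insert_self i D
    have h := ih (fun j hj => hxA j (hm j hj)) (fun j hj => hyA j (hm j hj))
      (fun j hj k hk => hxx j (hm j hj) k (hm k hk))
      (fun j hj k hk => hyx j (hm j hj) k (hm k hk))
    have hS : Q.IsSingular (Q.span (A ∪ x '' D)) := by
      apply hQ.isSingular_span
      rintro p (hp | ⟨j, hj, rfl⟩) q (hq | ⟨k, hk, rfl⟩)
      · exact hA.2 p hp q hq
      · exact (hxA k (hm k hk) p hp).symm
      · exact hxA j (hm j hj) q hq
      · exact hxx j (hm j hj) k (hm k hk)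
    have hxS : ∀ s ∈ Q.span (A ∪ x '' D), Q.Collinear (x i) s := by
      apply hQ.collinear_span
      rintro q (hq | ⟨k, hk, rfl⟩)
      · exact hxA i hi' q hq
      · exact hxx i hi' k (hm k hk)
    have hyS : ∀ s ∈ Q.span (A ∪ x '' D), Q.Collinear (y i) s := by
      apply hQ.collinear_span
      rintro q (hq | ⟨k, hk, rfl⟩)
      · exact hyA i hi' q hq
      · exact (hyx i hi' k (hm k hk)).2 (by rintro rfl; exact hi hk)
    rw [Finset.coe_insert, Set.image_insert_eq, Set.union_insert, ← span_insert_span,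
      hQ.rk_span_insert hS hxS fun h => ?_, h, Finset.card_insert_of_notMem hi, add_assoc]
    exact (hyx i hi' i hi').1 (hyS _ h) rfl

end IsPolarSpace

end PartialLinearSpace

/-! ### Hyperbolic systems, frames and partners -/

namespace PartialLinearSpace

variable {P : Type*} {Q : PartialLinearSpace P} {ι : Type*}

/-- A family of pairs of points in which two points are non-collinear if and only if they are the
two different points of a pair. -/
def IsHyperbolicSystem (Q : PartialLinearSpace P) (x : ι → Bool → P) : Prop :=
  ∀ i j a b, Q.Collinear (x i a) (x j b) ↔ (i = j → a = b)

/-- The subspace spanned by one point from each pair. -/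
def choiceSpan (Q : PartialLinearSpace P) (x : ι → Bool → P) (v : ι → Bool) : Set P :=
  Q.span (Set.range fun i => x i (v i))

theorem mem_choiceSpan (x : ι → Bool → P) (v : ι → Bool) (i : ι) :
    x i (v i) ∈ Q.choiceSpan x v :=
  Q.subset_span _ ⟨i, rfl⟩

namespace IsHyperbolicSystem

variable {x : ι → Bool → P} {n : ℕ}

theorem isSingular_choiceSpan (hQ : Q.IsPolarSpace) (hx : Q.IsHyperbolicSystem x)
    (v : ι → Bool) : Q.IsSingular (Q.choiceSpan x v) := by
  apply hQ.isSingular_span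
  rintro _ ⟨i, rfl⟩ _ ⟨j, rfl⟩
  exact (hx i j _ _).2 (by rintro rfl; rfl)

theorem rk_span_image (hQ : Q.IsPolarSpace) (hx : Q.IsHyperbolicSystem x) (v : ι → Bool)
    (D : Finset ι) : Q.rk (Q.span ((fun i => x i (v i)) '' D)) = D.card := by
  have h := hQ.rk_span_union_image Q.isSingular_empty (fun i => x i (v i))
    (fun i => x i (!v i)) D (by simp) (by simp)
    (fun i _ j _ => (hx i j _ _).2 (by rintro rfl; rfl))
    (fun i _ j _ => by
      rw [hx i j]
      refine ⟨fun h hij => ?_, fun h hij => absurd hij h⟩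
      subst hij
      simp at h)
  simpa [Q.rk_empty] using h

theorem isMaximalSingular_choiceSpan [Fintype ι] (hQ : Q.IsPolarSpace) (hn : Q.HasRank n)
    (hx : Q.IsHyperbolicSystem x) (hcard : Fintype.card ι = n) (v : ι → Bool) :
    Q.IsMaximalSingular (Q.choiceSpan x v) := by
  refine (hQ.isMaximalSingular_iff hn).2 ⟨hx.isSingular_choiceSpan hQ v, ?_⟩
  have h := hx.rk_span_image hQ v Finset.univ
  rwa [Finset.coe_univ, Set.image_univ, Finset.card_univ, hcard] at h

/-- For the upper bound, the points `x i (v i)` with `v i ≠ w i` are independent over the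
intersection, the points `x i (w i)` being a dual family, and everything lies in a subspace of rank
at most `n`. For the lower bound, the intersection contains the common points of the two choices. -/
theorem rk_inter_choiceSpan [Fintype ι] (hQ : Q.IsPolarSpace) (hn : Q.HasRank n)
    (hx : Q.IsHyperbolicSystem x) (hcard : Fintype.card ι = n) (v w : ι → Bool) :
    Q.rk (Q.choiceSpan x v ∩ Q.choiceSpan x w) + hammingDist v w = n := by
  classical
  have hv := hx.isSingular_choiceSpan hQ v
  have hw := hx.isSingular_choiceSpan hQ w
  have hvw := hv.mono (hv.1.inter hw.1) Set.inter_subset_left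
  apply le_antisymm
  · have h := hQ.rk_span_union_image hvw (fun i => x i (v i)) (fun i => x i (w i))
      (Finset.univ.filter fun i => v i ≠ w i)
      (fun i _ s hs => hv.2 _ (mem_choiceSpan x v i) s hs.1)
      (fun i _ s hs => hw.2 _ (mem_choiceSpan x w i) s hs.2)
      (fun i _ j _ => hv.2 _ (mem_choiceSpan x v i) _ (mem_choiceSpan x v j))
      (fun i hi j _ => by
        rw [hx i j]
        refine ⟨fun h hij => ?_, fun h hij => absurd hij h⟩
        subst hij
        exact (Finset.mem_filter.1 hi).2 (h rfl).symm)
    rw [hammingDist, ← h]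
    refine hQ.rk_le_rank hn (hv.mono (Q.isSubspace_span _) (span_subset hv.1 ?_))
    rintro p (hp | ⟨i, -, rfl⟩)
    · exact hp.1
    · exact mem_choiceSpan x v i
  · have h := hx.rk_span_image hQ v (Finset.univ.filter fun i => v i = w i)
    have h1 : Q.rk (Q.span ((fun i => x i (v i)) '' (Finset.univ.filter fun i => v i = w i))) ≤
        Q.rk (Q.choiceSpan x v ∩ Q.choiceSpan x w) := by
      refine hQ.rk_le_of_subset hvw (Q.isSubspace_span _) (span_subset hvw.1 ?_)
      rintro _ ⟨i, hi, rfl⟩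
      refine ⟨mem_choiceSpan x v i, ?_⟩
      have hi' : v i = w i := by simpa using hi
      simp only [hi']
      exact mem_choiceSpan x w i
    have h2 := Finset.card_filter_add_card_filter_not (s := Finset.univ) fun i => v i = w i
    rw [Finset.card_univ, hcard] at h2
    rw [h] at h1
    rw [hammingDist]
    simp only [ne_eq]
    omega

theorem isFrame [Fintype ι] (hx : Q.IsHyperbolicSystem x) (hcard : Fintype.card ι = n) :
    Q.IsFrame n (Set.range fun k : ι × Bool => x k.1 k.2) := by
  have hinj : Function.Injective fun k : ι × Bool => x k.1 k.2 := by
    rintro ⟨i, a⟩ ⟨j, b⟩ h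
    have h : x i a = x j b := h
    have h1 : ¬ Q.Collinear (x i (!a)) (x j b) := by
      rw [← h, hx]
      simp
    rw [hx] at h1
    push Not at h1
    obtain ⟨rfl, h1⟩ := h1
    cases a <;> cases b <;> simp_all
  constructor
  · rw [← Set.image_univ, hinj.encard_image, Set.encard_univ, ENat.card_eq_coe_fintype_card,
      Fintype.card_prod, hcard, Fintype.card_bool]
    push_cast
    ring
  · rintro _ ⟨⟨i, a⟩, rfl⟩
    refine ⟨x i (!a), ⟨⟨(i, !a), rfl⟩, by simp [hx i i]⟩, ?_⟩
    rintro _ ⟨⟨⟨j, b⟩, rfl⟩, h⟩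
    simp only [hx i j] at h
    push Not at h
    obtain ⟨rfl, h⟩ := h
    cases a <;> cases b <;> simp_all

theorem apartment_eq [Fintype ι] (hQ : Q.IsPolarSpace) (hn : Q.HasRank n)
    (hx : Q.IsHyperbolicSystem x) (hcard : Fintype.card ι = n) :
    Q.apartment (Set.range fun k : ι × Bool => x k.1 k.2) = Set.range (Q.choiceSpan x) := by
  classical
  ext S
  constructor
  · rintro ⟨hS, X, hX, rfl⟩
    -- A singular span contains at most one point of each pair, so `X` lies in this choice; where it
    -- contains neither, `false` is taken. Maximality then gives equality.
    refine ⟨fun i => decide (x i true ∈ Q.span X), ?_⟩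
    refine (hS.eq_of_subset (hx.isSingular_choiceSpan hQ _) (span_mono fun p hp => ?_)).symm
    obtain ⟨⟨i, a⟩, rfl⟩ := hX hp
    refine ⟨i, ?_⟩
    have hp' := Q.subset_span X hp
    have ha : decide (x i true ∈ Q.span X) = a := by
      cases a
      · simp only [decide_eq_false_iff_not]
        intro h
        have := (hx i i _ _).1 (hS.1.2 _ hp' _ h) rfl
        simp at this
      · simpa using hp'
    simp only [ha]
  · rintro ⟨v, rfl⟩
    exact ⟨hx.isMaximalSingular_choiceSpan hQ hn hcard v, _,
      by rintro _ ⟨i, rfl⟩; exact ⟨(i, v i), rfl⟩, rfl⟩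

end IsHyperbolicSystem

/-- Every frame consists of the points of a hyperbolic system. -/
theorem IsFrame.exists_isHyperbolicSystem {n : ℕ} {B : Set P} (hB : Q.IsFrame n B) :
    ∃ x : Fin n → Bool → P, Q.IsHyperbolicSystem x ∧
      B = Set.range fun k : Fin n × Bool => x k.1 k.2 := by
  classical
  obtain ⟨hcard, hB⟩ := hB
  have hfin : B.Finite := Set.finite_of_encard_eq_coe (k := 2 * n) (by rw [hcard]; push_cast; rfl)
  lift B to Finset P using hfin
  rw [Set.encard_coe_eq_coe_finsetCard] at hcard
  have hcard : B.card = 2 * n := by exact_mod_cast hcard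
  choose! σ hσ using fun p hp => hB p hp
  simp only [Finset.mem_coe] at hσ
  have hσB : ∀ p ∈ B, σ p ∈ B := fun p hp => (hσ p hp).1.1
  have hnc : ∀ p ∈ B, ∀ q ∈ B, ¬ Q.Collinear p q ↔ q = σ p := fun p hp q hq =>
    ⟨fun h => (hσ p hp).2 q ⟨hq, h⟩, by rintro rfl; exact (hσ p hp).1.2⟩
  have hσσ : ∀ p ∈ B, σ (σ p) = p := fun p hp =>
    ((hnc _ (hσB p hp) _ hp).1 fun h => (hσ p hp).1.2 h.symm).symm
  have hne : ∀ p ∈ B, σ p ≠ p := fun p hp h =>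
    (hnc p hp p hp).2 h.symm (Q.collinear_refl p)
  -- An arbitrary linear order selects one point from each pair `{p, σ p}`.
  let : LinearOrder P := linearOrderOfSTO WellOrderingRel
  set X := B.filter fun p => p < σ p with hXdef
  have hXB : ∀ p ∈ X, p ∈ B := fun p hp => (Finset.mem_filter.1 hp).1
  have hXlt : ∀ p ∈ X, p < σ p := fun p hp => (Finset.mem_filter.1 hp).2
  have hX : X.card = n := by
    have h1 : (B.filter fun p => ¬ p < σ p) = X.image σ := by
      ext q
      simp only [Finset.mem_filter, Finset.mem_image, hXdef]
      constructor
      · rintro ⟨hq, hlt⟩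
        refine ⟨σ q, ⟨hσB q hq, ?_⟩, hσσ q hq⟩
        rw [hσσ q hq]
        exact (not_lt.1 hlt).lt_of_ne (hne q hq)
      · rintro ⟨p, ⟨hp, hlt⟩, rfl⟩
        refine ⟨hσB p hp, ?_⟩
        rw [hσσ p hp]
        exact hlt.not_gt
    have h2 := Finset.card_filter_add_card_filter_not (s := B) fun p => p < σ p
    rw [h1, Finset.card_image_of_injOn, ← hXdef] at h2
    · omega
    · intro p hp q hq h
      rw [← hσσ p (hXB p hp), ← hσσ q (hXB q hq), h]
  let e := (X.equivFinOfCardEq hX).symm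
  have he : ∀ i, (e i : P) ∈ B := fun i => hXB _ (e i).2
  have hlt : ∀ i, (e i : P) < σ (e i) := fun i => hXlt _ (e i).2
  refine ⟨fun i a => if a then e i else σ (e i), ?_, ?_⟩
  · have hnat : ∀ i j, (e i : P) ≠ σ (e j) := by
      intro i j h
      have h1 := hlt i
      rw [h, hσσ _ (he j)] at h1
      exact lt_asymm h1 (hlt j)
    have hinj : ∀ i j, σ (e i) = σ (e j) ↔ i = j := by
      intro i j
      refine ⟨fun h => e.injective (Subtype.ext ?_), by rintro rfl; rfl⟩
      rw [← hσσ _ (he i), h, hσσ _ (he j)]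
    intro i j a b
    cases a <;> cases b <;>
      simp only [if_true, if_false, Bool.false_eq_true, implies_true, iff_true, reduceCtorEq,
        imp_false]
    · by_contra h
      rw [hnc _ (hσB _ (he i)) _ (hσB _ (he j)), hσσ _ (he i)] at h
      exact hnat i j h.symm
    · rw [← not_iff_not, not_not, hnc _ (hσB _ (he i)) _ (he j), hσσ _ (he i)]
      refine ⟨fun h => (e.injective (Subtype.ext h)).symm, by rintro rfl; rfl⟩
    · rw [← not_iff_not, not_not, hnc _ (he i) _ (hσB _ (he j)), hinj]
      exact eq_comm
    · by_contra h
      rw [hnc _ (he i) _ (he j)] at h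
      exact hnat j i h
  · ext p
    simp only [Finset.mem_coe, Set.mem_range, Prod.exists, Bool.exists_bool]
    constructor
    · intro hp
      by_cases h : p < σ p
      · exact ⟨X.equivFinOfCardEq hX ⟨p, Finset.mem_filter.2 ⟨hp, h⟩⟩, Or.inr (by simp [e])⟩
      · have hp' : σ p ∈ X := by
          refine Finset.mem_filter.2 ⟨hσB p hp, ?_⟩
          rw [hσσ p hp]
          exact (not_lt.1 h).lt_of_ne (hne p hp)
        exact ⟨X.equivFinOfCardEq hX ⟨σ p, hp'⟩, Or.inl (by simp [e, hσσ p hp])⟩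
    · rintro ⟨i, rfl | rfl⟩
      · simpa using hσB _ (he i)
      · simpa using he i

namespace IsPolarSpace

/-- A point outside the span of the other points has a partner, which can be chosen in the perp of
given partners of some of the other points. -/
theorem exists_partner (hQ : Q.IsPolarSpace) [Fintype ι] {a : ι → P}
    (ha : ∀ i j, Q.Collinear (a i) (a j)) {k : ι} (hk : a k ∉ Q.span (a '' {k}ᶜ))
    (J : Finset ι) (b : ι → P) (hkJ : k ∉ J)
    (hb : ∀ j ∈ J, ∀ i, Q.Collinear (b j) (a i) ↔ j ≠ i) :
    ∃ z, (∀ i, Q.Collinear z (a i) ↔ k ≠ i) ∧ ∀ j ∈ J, Q.Collinear z (b j) := by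
  classical
  induction J using Finset.induction with
  | empty =>
    have hcoe : (((Finset.univ.erase k).image a : Finset P) : Set P) = a '' {k}ᶜ := by
      ext; simp
    obtain ⟨z, h1, h2⟩ := hQ.exists_perp_not_collinear ((Finset.univ.erase k).image a) (a k)
      (by
        intro x hx y hy
        obtain ⟨i, -, rfl⟩ := Finset.mem_image.1 hx
        obtain ⟨j, -, rfl⟩ := Finset.mem_image.1 hy
        exact ha i j)
      (by
        intro x hx
        obtain ⟨i, -, rfl⟩ := Finset.mem_image.1 hx
        exact ha k i)
      (by rwa [hcoe])
    refine ⟨z, fun i => ⟨by rintro h rfl; exact h2 h, fun hi => h1 _ ?_⟩, by simp⟩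
    exact Finset.mem_image_of_mem a (by simp [hi.symm])
  | insert j J hj ih =>
    have hm : ∀ l ∈ J, l ∈ insert j J := fun l hl => Finset.mem_insert_of_mem hl
    have hj' := Finset.mem_insert_self j J
    have hkj : k ≠ j := by rintro rfl; exact hkJ hj'
    obtain ⟨z, hz, hzb⟩ := ih (fun h => hkJ (hm k h)) fun l hl => hb l (hm l hl)
    -- Sliding `z` along its line to `a j` reaches the perp of `b j`. Nothing is lost, since `a j`
    -- is collinear with all `a i` and with the earlier `b l`; and `y ≠ a j` keeps `y` non-collinear
    -- with `a k`.
    obtain ⟨y, L, hL, hjL, hzL, hyL, hby, hyj⟩ := hQ.exists_collinear_ne ((hz j).2 hkj).symm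
      (fun h => (hb j hj' j).1 h rfl)
    have hzj : z ≠ a j := fun h => (hz k).1 (h ▸ ha j k) rfl
    have hperp : ∀ p, Q.Collinear z p → Q.Collinear (a j) p → Q.Collinear y p := fun p h1 h2 =>
      (hQ.collinear_of_mem_line hL hzL hjL hyL hzj h1.symm h2.symm).symm
    refine ⟨y, fun i => ⟨?_, fun hi => hperp _ ((hz i).2 hi) (ha j i)⟩, fun l hl => ?_⟩
    · rintro h rfl
      refine (hz k).1 ?_ rfl
      exact (hQ.collinear_of_mem_line hL hyL hjL hzL hyj h.symm (ha k j)).symm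
    · obtain rfl | hl' := Finset.mem_insert.1 hl
      · exact hby.symm
      · exact hperp _ (hzb l hl') ((hb l hl j).2 (by rintro rfl; exact hj hl')).symm

/-- Partners of some points of an independent family can be extended to partners of all points. -/
theorem exists_partners (hQ : Q.IsPolarSpace) [Fintype ι] {a : ι → P}
    (ha : ∀ i j, Q.Collinear (a i) (a j)) (hind : ∀ k, a k ∉ Q.span (a '' {k}ᶜ))
    (J : Finset ι) (b : ι → P) (hb : ∀ j ∈ J, ∀ i, Q.Collinear (b j) (a i) ↔ j ≠ i)
    (hbb : ∀ j ∈ J, ∀ l ∈ J, Q.Collinear (b j) (b l)) :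
    ∃ c : ι → P, (∀ j i, Q.Collinear (c j) (a i) ↔ j ≠ i) ∧
      (∀ j l, Q.Collinear (c j) (c l)) ∧ ∀ j ∈ J, c j = b j := by
  classical
  have h : ∀ K : Finset ι, ∃ c : ι → P,
      (∀ j ∈ J ∪ K, ∀ i, Q.Collinear (c j) (a i) ↔ j ≠ i) ∧
      (∀ j ∈ J ∪ K, ∀ l ∈ J ∪ K, Q.Collinear (c j) (c l)) ∧ ∀ j ∈ J, c j = b j := by
    intro K
    induction K using Finset.induction with
    | empty => exact ⟨b, by simpa using hb, by simpa using hbb, fun _ _ => rfl⟩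
    | insert k K _ ih =>
      obtain ⟨c, h1, h2, h3⟩ := ih
      rw [Finset.union_insert]
      by_cases hk : k ∈ J ∪ K
      · rw [Finset.insert_eq_of_mem hk]
        exact ⟨c, h1, h2, h3⟩
      obtain ⟨z, hz, hzc⟩ := hQ.exists_partner ha (hind k) (J ∪ K) c hk h1
      have hc : ∀ j ∈ J ∪ K, Function.update c k z j = c j := fun j hj =>
        Function.update_of_ne (by rintro rfl; exact hk hj) _ _
      refine ⟨Function.update c k z, fun j hj => ?_, fun j hj l hl => ?_, fun j hj => ?_⟩
      · obtain rfl | hj := Finset.mem_insert.1 hj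
        · simpa using hz
        · rw [hc j hj]
          exact h1 j hj
      · obtain rfl | hj' := Finset.mem_insert.1 hj <;> obtain rfl | hl' := Finset.mem_insert.1 hl
        · exact Q.collinear_refl _
        · rw [hc l hl', Function.update_self]
          exact hzc l hl'
        · rw [hc j hj', Function.update_self]
          exact (hzc j hj').symm
        · rw [hc j hj', hc l hl']
          exact h2 j hj' l hl'
      · rw [hc j (Finset.mem_union_left _ hj)]
        exact h3 j hj
  obtain ⟨c, h1, h2, h3⟩ := h Finset.univ
  exact ⟨c, fun j i => h1 j (by simp) i, fun j l => h2 j (by simp) l (by simp), h3⟩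

end IsPolarSpace

end PartialLinearSpace

/-! ### From isometric embeddings to apartments -/

namespace PartialLinearSpace

variable {P : Type*} {Q : PartialLinearSpace P}

namespace IsPolarSpace

/-- If the ranks of the intersections of maximal singular subspaces `F v` are those of an isometric
embedding of the hypercube, then the `F v` are spanned by the intersection of all of them together
with one point from each pair of a hyperbolic system. -/
theorem exists_pairs_of_rk_inter (hQ : Q.IsPolarSpace) {n m : ℕ} (hn : Q.HasRank n) (hm : m ≤ n)
    {F : (Fin m → Bool) → Set P} (hF : ∀ v, Q.IsMaximalSingular (F v))
    (hrk : ∀ v w, Q.rk (F v ∩ F w) + hammingDist v w = n) :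
    ∃ (M : Set P) (x : Fin m → Bool → P), Q.IsSingular M ∧ Q.rk M = n - m ∧
      Q.IsHyperbolicSystem x ∧
      ∀ v, F v = Q.span (M ∪ Set.range fun i => x i (v i)) := by
  have hsub : ∀ v w, Q.IsSubspace (F v ∩ F w) := fun v w => (hF v).1.1.inter (hF w).1.1
  have hrkF : ∀ v, Q.rk (F v) = n := fun v => ((hQ.isMaximalSingular_iff hn).1 (hF v)).2
  -- Inside `F u`, modularity gives the triple intersection rank at least `n - hammingDist v w`, the
  -- rank of `F v ∩ F w`.
  have hbetween : ∀ u v w, (∀ i, u i = v i ∨ u i = w i) → F v ∩ F w ⊆ F u := by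
    intro u v w h
    have h1 := hQ.rk_add_rk_le (hF u).1 (hsub v u) (hsub u w) Set.inter_subset_right
      Set.inter_subset_left
    have h2 := hammingDist_add_of_between h
    have h3 := hQ.eq_of_subset_of_rk_le ((hF v).1.mono (hsub v w) Set.inter_subset_left)
      ((hsub v u).inter (hsub u w)) (fun p hp => ⟨hp.1.1, hp.2.2⟩)
      (by have := hrk v u; have := hrk u w; have := hrk v w; rw [hrkF] at h1; omega)
    rw [← h3]
    exact fun p hp => hp.1.2
  set M := F (fun _ => true) ∩ F (fun _ => false) with hMdef
  have hMsing : Q.IsSingular M := (hF _).1.mono (hsub _ _) Set.inter_subset_left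
  have hopp : ∀ v : Fin m → Bool, hammingDist v (fun i => !v i) = m := fun v => by
    rw [hammingDist_not_right, Fintype.card_fin]
  have hMrk : Q.rk M = n - m := by
    have h1 : Q.rk M + hammingDist (fun _ : Fin m => true) (fun _ => false) = n := hrk _ _
    have h2 : hammingDist (fun _ : Fin m => true) (fun _ => false) = m := hopp fun _ => true
    omega
  have hMF : ∀ v, M ⊆ F v := fun v => hbetween v _ _ fun i => by cases v i <;> simp
  have hM : ∀ v, F v ∩ F (fun i => !v i) = M := by
    intro v
    refine (hQ.eq_of_subset_of_rk_le ((hF v).1.mono (hsub _ _) Set.inter_subset_left) hMsing.1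
      (Set.subset_inter (hMF v) (hMF _)) ?_).symm
    have h1 := hrk v fun i => !v i
    rw [hopp] at h1
    omega
  -- `u i a` has the value `a` at `i` only. Its distance from the constant `a` is `m - 1`, so the
  -- corresponding intersection has rank one more than `M` and supplies `x i a`.
  let u : Fin m → Bool → Fin m → Bool := fun i a => Function.update (fun _ => !a) i a
  have hu1 : ∀ i a, hammingDist (u i a) (fun _ => !a) = 1 := fun i a =>
    hammingDist_update_self _ i (by simp)
  have hu : ∀ i a, hammingDist (fun _ => a) (u i a) + 1 = m := by
    intro i a
    rw [← hu1 i a, hammingDist_add_of_between, hopp fun _ => a]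
    intro j
    by_cases hj : j = i
    · subst hj; simp [u]
    · simp [u, hj]
  have hx : ∀ i a, ∃ p, p ∈ F (fun _ => a) ∩ F (u i a) ∧ p ∉ M := by
    intro i a
    by_contra! h
    have h1 := hQ.rk_le_of_subset hMsing (hsub _ _) h
    have h2 := hrk (fun _ => a) (u i a)
    have h3 := hu i a
    omega
  choose x hx hxM using hx
  have hxF : ∀ i a v, v i = a → x i a ∈ F v := by
    intro i a v hv
    refine hbetween v _ _ (fun j => ?_) (hx i a)
    by_cases hj : j = i
    · subst hj; exact Or.inl hv
    · simp only [u, Function.update_of_ne hj]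
      cases v j <;> cases a <;> simp
  have hxopp : ∀ i a, x i a ∉ F (fun _ => !a) := fun i a h =>
    hxM i a (hM (fun _ => a) ▸ ⟨(hx i a).1, h⟩)
  -- `F (u i a)` is spanned by `x i a` and its hyperplane in `F (fun _ => !a)`. If `x i (!a)` were
  -- collinear with `x i a`, it would lie in `F (u i a)` by maximality, and also in the antipodal
  -- subspace, hence in `M`.
  have hnc : ∀ i a, ¬ Q.Collinear (x i a) (x i !a) := by
    intro i a hcol
    have hH := (hF (u i a)).1.mono (hsub (u i a) fun _ => !a) Set.inter_subset_left
    have h1 := hQ.rk_span_insert hH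
      (fun s hs => (hF (u i a)).1.2 _ (hx i a).2 s hs.1) (fun h => hxopp i a h.2)
    have h2 : Q.span (insert (x i a) (F (u i a) ∩ F fun _ => !a)) = F (u i a) := by
      refine hQ.eq_of_subset_of_rk_le (hF _).1 (Q.isSubspace_span _) (span_subset (hF _).1.1
        (Set.insert_subset (hx i a).2 Set.inter_subset_left)) ?_
      have h3 := hrk (u i a) fun _ => !a
      rw [hu1] at h3
      rw [hrkF]
      omega
    have h3 : x i (!a) ∈ F (u i a) := by
      apply hQ.mem_of_isMaximalSingular (hF _)
      rw [← h2]
      apply hQ.collinear_span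
      rintro y (rfl | hy)
      · exact hcol.symm
      · exact (hF _).1.2 _ (hx i !a).1 _ hy.2
    refine hxM i (!a) (hM (u i a) ▸ ⟨h3, hxF _ _ _ ?_⟩)
    simp [u]
  have hsys : Q.IsHyperbolicSystem x := by
    intro i j a b
    constructor
    · rintro h rfl
      by_contra hab
      obtain rfl : b = !a := by cases a <;> cases b <;> simp_all
      exact hnc i a h
    · intro h
      by_cases hij : i = j
      · subst hij
        rw [h rfl]
        exact Q.collinear_refl _
      · refine (hF (Function.update (fun _ => a) j b)).1.2 _ (hxF _ _ _ ?_) _ (hxF _ _ _ ?_)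
        · simp [hij]
        · simp
  refine ⟨M, x, hMsing, hMrk, hsys, fun v => ?_⟩
  have hmem : ∀ i, x i (v i) ∈ F v := fun i => hxF i _ v rfl
  -- The opposite points `x i (!v i)` form the dual family, so the span has rank `(n - m) + m = n`.
  have h := hQ.rk_span_union_image hMsing (fun i => x i (v i)) (fun i => x i (!v i)) Finset.univ
    (fun i _ s hs => (hF v).1.2 _ (hmem i) s (hMF v hs))
    (fun i _ s hs => (hF fun _ => !v i).1.2 _ (hx i _).1 s (hMF _ hs))
    (fun i _ j _ => (hF v).1.2 _ (hmem i) _ (hmem j))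
    (fun i _ j _ => by
      rw [hsys i j]
      refine ⟨fun h hij => ?_, fun h hij => absurd hij h⟩
      subst hij
      simp at h)
  rw [Finset.coe_univ, Set.image_univ, Finset.card_univ, Fintype.card_fin] at h
  refine (hQ.eq_of_subset_of_rk_le (hF v).1 (Q.isSubspace_span _) (span_subset (hF v).1.1 ?_)
    (by rw [h, hrkF]; omega)).symm
  refine Set.union_subset (hMF v) ?_
  rintro _ ⟨i, rfl⟩
  exact hmem i

/-- The image of an isometric embedding of a hypercube in the dual polar graph is an apartment. -/
theorem exists_isParabolicApartment (hQ : Q.IsPolarSpace) {n m : ℕ} (hn : Q.HasRank n)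
    (hm : m ≤ n) {F : (Fin m → Bool) → Set P} (hF : ∀ v, Q.IsMaximalSingular (F v))
    (hrk : ∀ v w, Q.rk (F v ∩ F w) + hammingDist v w = n) :
    ∃ M : Set P, M ∈ Q.grassmannian ((n : ℤ) - m - 1) ∧
      Q.IsParabolicApartment n M (Set.range F) := by
  classical
  obtain ⟨M, x, hM, hMrk, hx, hFx⟩ := hQ.exists_pairs_of_rk_inter hn hm hF hrk
  refine ⟨M, hQ.mem_grassmannian_iff.2 ⟨hM, by omega⟩, ?_⟩
  obtain ⟨E, hE, hEM⟩ := hQ.exists_finset_span_eq hM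
  let e : Fin (n - m) → P := fun i => (E.equivFinOfCardEq (hE.trans hMrk)).symm i
  have he : Set.range e = E := by
    have : e = Subtype.val ∘ (E.equivFinOfCardEq (hE.trans hMrk)).symm := rfl
    rw [this, Set.range_comp, Equiv.range_eq_univ, Set.image_univ, Subtype.range_coe]
  have heM : Q.span (Set.range e) = M := by rw [he, hEM]
  have hemem : ∀ j, e j ∈ M := fun j => heM ▸ Q.subset_span _ ⟨j, rfl⟩
  have hFe : ∀ v, F v = Q.span (Set.range (Sum.elim (fun i => x i (v i)) e)) := by
    intro v
    rw [hFx v, Set.Sum.elim_range]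
    apply (span_subset (Q.isSubspace_span _) _).antisymm (span_subset (Q.isSubspace_span _) _)
    · refine Set.union_subset ?_ (Set.subset_union_left.trans (Q.subset_span _))
      rw [← heM]
      exact span_mono Set.subset_union_right
    · refine Set.union_subset (Set.subset_union_right.trans (Q.subset_span _)) ?_
      rintro _ ⟨j, rfl⟩
      exact Q.subset_span _ (Or.inl (hemem j))
  have hMF : ∀ v, M ⊆ F v := fun v => by
    rw [hFx v]
    exact Set.subset_union_left.trans (Q.subset_span _)
  have hxF : ∀ v i, x i (v i) ∈ F v := fun v i => by
    rw [hFx v]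
    exact Q.subset_span _ (Or.inr ⟨i, rfl⟩)
  have hxM : ∀ i a, ∀ s ∈ M, Q.Collinear (x i a) s := fun i a s hs =>
    (hF fun _ => a).1.2 _ (hxF (fun _ => a) i) s (hMF _ hs)
  set a : Fin m ⊕ Fin (n - m) → P := Sum.elim (fun i => x i true) e with hadef
  have haF : F (fun _ => true) = Q.span (Set.range a) := hFe _
  have ha : ∀ i j, Q.Collinear (a i) (a j) := by
    have h : ∀ i, a i ∈ F (fun _ => true) := fun i => haF ▸ Q.subset_span _ ⟨i, rfl⟩
    exact fun i j => (hF _).1.2 _ (h i) _ (h j)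
  have hcard : Fintype.card (Fin m ⊕ Fin (n - m)) = n := by simp; omega
  -- The `n` points `a i` span a subspace of rank `n`, so none of them is redundant.
  have hind : ∀ k, a k ∉ Q.span (a '' {k}ᶜ) := by
    intro k hk
    have hcoe : (((Finset.univ.erase k).image a : Finset P) : Set P) = a '' {k}ᶜ := by
      ext; simp
    have hspan : Q.span (a '' {k}ᶜ) = F fun _ => true := by
      rw [haF]
      apply (span_mono (Set.image_subset_range _ _)).antisymm
      apply span_subset (Q.isSubspace_span _)
      rintro _ ⟨i, rfl⟩
      by_cases hi : i = k
      · exact hi ▸ hk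
      · exact Q.subset_span _ ⟨i, hi, rfl⟩
    have h1 := rk_span_le (Q := Q) ((Finset.univ.erase k).image a)
    rw [hcoe, hspan, ((hQ.isMaximalSingular_iff hn).1 (hF _)).2] at h1
    have h2 := h1.trans Finset.card_image_le
    rw [Finset.card_erase_of_mem (Finset.mem_univ k), Finset.card_univ, hcard] at h2
    have h3 : 0 < Fintype.card (Fin m ⊕ Fin (n - m)) := Fintype.card_pos_iff.2 ⟨k⟩
    omega
  -- The partners `x i false` are prescribed on the left summand only; the values `e` on the right
  -- one are dummies.
  obtain ⟨c, hca, hcc, hcb⟩ := hQ.exists_partners ha hind (Finset.univ.image Sum.inl)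
    (Sum.elim (fun i => x i false) e)
    (by
      intro j hj i
      obtain ⟨j, -, rfl⟩ := Finset.mem_image.1 hj
      obtain i | i := i
      · simp [hadef, hx j i]
      · simpa [hadef] using hxM j false _ (hemem i))
    (by
      intro j hj l hl
      obtain ⟨j, -, rfl⟩ := Finset.mem_image.1 hj
      obtain ⟨l, -, rfl⟩ := Finset.mem_image.1 hl
      simp [hx j l])
  let X : Fin m ⊕ Fin (n - m) → Bool → P := fun i b => if b then a i else c i
  have hX : Q.IsHyperbolicSystem X := by
    intro i j b d
    cases b <;> cases d <;> simp only [X, if_true, if_false, Bool.false_eq_true, implies_true,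
      iff_true, reduceCtorEq, imp_false]
    · exact hcc i j
    · exact hca i j
    · rw [collinear_comm, hca, ne_comm]
    · exact ha i j
  have hXl : ∀ i b, X (Sum.inl i) b = x i b := by
    intro i b
    cases b
    · simpa [X] using hcb (Sum.inl i) (by simp)
    · simp [X, hadef]
  have hXF : ∀ v, F v = Q.choiceSpan X (Sum.elim v fun _ => true) := by
    intro v
    rw [hFe, choiceSpan]
    congr 2
    ext i
    obtain i | i := i
    · simp [hXl]
    · simp [X, hadef]
  refine ⟨_, hX.isFrame hcard, ⟨Set.range e, ?_, heM⟩, ?_⟩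
  · rintro _ ⟨j, rfl⟩
    exact ⟨(Sum.inr j, true), by simp [X, hadef]⟩
  · rw [hX.apartment_eq hQ hn hcard]
    ext S
    constructor
    · rintro ⟨v, rfl⟩
      exact ⟨⟨_, (hXF v).symm⟩,
        (hQ.mem_grassmannian_iff_isMaximalSingular hn).2 (hF v), hMF v⟩
    -- A member of the apartment containing `M` contains every `e j`, so it cannot choose the
    -- partner of `e j`; only the choices on the first `m` pairs are free.
    · rintro ⟨⟨v, rfl⟩, -, hMv⟩
      refine ⟨fun i => v (Sum.inl i), ?_⟩
      rw [hXF]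
      congr 1
      ext i
      obtain i | j := i
      · rfl
      · have h1 : X (Sum.inr j) true ∈ Q.choiceSpan X v := hMv (hemem j)
        exact (hX _ _ _ _).1 ((hX.isSingular_choiceSpan hQ v).2 _ h1 _
          (mem_choiceSpan X v (Sum.inr j))) rfl

end IsPolarSpace

end PartialLinearSpace

/-! ### The theorem -/

theorem theorem2 {P : Type*} (Q : PartialLinearSpace P) (hQ : Q.IsPolarSpace)
    (n : ℕ) (hn : Q.HasRank n) :
    (∀ m : ℕ, m ≤ n →
      ∀ f : (Fin m → Bool) → Q.grassmannian ((n : ℤ) - 1),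
        IsIsometricEmbedding (hypercubeGraph m) (Q.dualPolarGraph n) f →
          ∃ M : Set P, M ∈ Q.grassmannian ((n : ℤ) - m - 1) ∧
            Q.IsParabolicApartment n M (Set.range fun v => (f v : Set P))) ∧
    (∀ 𝒜 : Set (Set P), Q.IsApartment n 𝒜 ↔
      ∃ f : (Fin n → Bool) → Q.grassmannian ((n : ℤ) - 1),
        IsIsometricEmbedding (hypercubeGraph n) (Q.dualPolarGraph n) f ∧
          𝒜 = Set.range fun v => (f v : Set P)) := by
  have main : ∀ m : ℕ, m ≤ n → ∀ f : (Fin m → Bool) → Q.grassmannian ((n : ℤ) - 1),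
      IsIsometricEmbedding (hypercubeGraph m) (Q.dualPolarGraph n) f →
        ∃ M : Set P, M ∈ Q.grassmannian ((n : ℤ) - m - 1) ∧
          Q.IsParabolicApartment n M (Set.range fun v => (f v : Set P)) := fun m hm f hf =>
    hQ.exists_isParabolicApartment hn hm
      (fun v => (hQ.mem_grassmannian_iff_isMaximalSingular hn).1 (f v).2)
      ((hQ.isIsometricEmbedding_iff hn f).1 hf)
  refine ⟨main, fun 𝒜 => ⟨?_, ?_⟩⟩
  · rintro ⟨B, hB, rfl⟩
    obtain ⟨x, hx, rfl⟩ := hB.exists_isHyperbolicSystem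
    have hcard := Fintype.card_fin n
    refine ⟨fun v => ⟨Q.choiceSpan x v, (hQ.mem_grassmannian_iff_isMaximalSingular hn).2
      (hx.isMaximalSingular_choiceSpan hQ hn hcard v)⟩, ?_, hx.apartment_eq hQ hn hcard⟩
    exact (hQ.isIsometricEmbedding_iff hn _).2 (hx.rk_inter_choiceSpan hQ hn hcard)
  · rintro ⟨f, hf, rfl⟩
    obtain ⟨M, hM, B, hB, -, hA⟩ := main n le_rfl f hf
    obtain ⟨hMsing, hMrk⟩ := hQ.mem_grassmannian_iff.1 hM
    -- For `m = n` the dimension of `M` is `-1`, so its rank is zero and containing `M` is no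
    -- restriction.
    have hM0 : ∅ = M := hQ.eq_of_subset_of_rk_le hMsing Q.isSubspace_empty
      (Set.empty_subset M) (by omega)
    refine ⟨B, hB, ?_⟩
    rw [hA, Set.inter_eq_left]
    intro S hS
    exact ⟨(hQ.mem_grassmannian_iff_isMaximalSingular hn).2 hS.1, hM0 ▸ Set.empty_subset S⟩
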